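/- Work on $[0,1]$ with Lebesgue measure $\mathbb P$, and identify random variables (real measurable functions) that agree a.s. Write $X\sim Y$ if $X,Y$ have the same law, $\mathbb E$ for the expectation, $X^*(t)=\inf\{\lambda>0:\mathbb P(|X|>\lambda)\le t\}$, $t\in(0,1)$, for the decreasing rearrangement, and let $$\|X\|=\sup_{n\ge 1}\Big(n2^n\int_0^{\frac1{2^n n!}}X^*(t)\,\mathrm dt\Big),\qquad \mathcal X=\{X:\|X\|<\infty\}.$$ Then the following hold. 1. $(\mathcal X,\|\cdot\|)$ is a rearrangement-invariant space: it is a nonzero Banach space such that, for $X\in\mathcal X$, $|Y|\le|X|$ a.s. implies $Y\in\mathcal X$, $\|Y\|\le\|X\|$, and $Z\sim X$ implies $Z\in\mathcal X$, $\|Z\|=\|X\|$. Moreover $\mathcal X\subset L^1$, and $\mathcal X$ is monotonically complete: the pointwise supremum of every increasing norm bounded sequence of nonnegative elements of $\mathcal X$ belongs to $\mathcal X$. 2. Let $\mathcal S=\operatorname{Span}\{X-Y: X,Y\in\mathcal X,\ X\sim Y\}$ and $\mathcal M=\{X\in\mathcal X:\mathbb E[X]=0\}$. Then $\overline{\mathcal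 S}\subsetneq\mathcal M$, the closure being taken in norm. Explicitly, with $c_n=\frac{1}{2^n(n+1)!}$ and $Y=\sum_{n\ge3}n!\,\mathbf 1_{[c_{n+1},c_n)}$, one has $Y\in\mathcal X$ and $Y-\mathbb E[Y]\mathbf 1\in\mathcal M\setminus\overline{\mathcal S}$. 3. There is a positive bounded linear functional $\rho:\mathcal X\to\mathbb R$ that is law-invariant ($\rho(X)=\rho(Y)$ whenever $X\sim Y$) but is not a scalar multiple of the expectation. 4. $\mathcal X$ satisfies none of the following three conditions. * (AOCEA) For every $0\le X\in\mathcal X$, the distance between the convex hull of $\{Y:Y\sim X\}$ and $\mathcal X_a=\{V\in\mathcal X:\lim_{\mathbb P(A)\to0}\|V\mathbf 1_A\|=0\}$ is $0$. * For every $0\le X\in\mathcal X$, every $\varepsilon>0$ and every sequence of measurable sets $A_n\downarrow\emptyset$ there are indices $n_1,\dots,n_k$, random variables $Z_i\sim X\mathbf 1_{A_{n_i}}$ and a convex combination with $\|\sum_{i=1}^k\lambda_iZ_i\|<\varepsilon$. * For every $X\in\mathcal X$, every $\varepsilon>0$, every sequence of measurable sets $A_n\downarrow\emptyset$ with $\sum_n\mathbb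 P(A_n)\le1$ and every sequence of random variables $Z_n\sim X\mathbf 1_{A_n}$ that are pairwise disjoint (for $i\ne j$, $Z_iZ_j=0$ a.s.) there are $k\ge1$ and indices $n_1,\dots,n_k$ with $\|\frac1k\sum_{i=1}^kZ_{n_i}\|<\varepsilon$. -/

import Mathlib

open MeasureTheory ProbabilityTheory Filter Topology
open scoped ENNReal

noncomputable section

namespace RI

variable {Ω : Type*} [MeasurableSpace Ω]

/-- The decreasing rearrangement `X^*(t) = inf {r > 0 : μ(|X| > r) ≤ t}`, for `t ∈ (0,1)`. -/
def decRearr (μ : Measure Ω) (X : Ω → ℝ) (t : ℝ) : ℝ :=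
  sInf {r : ℝ | 0 < r ∧ μ {ω | r < |X ω|} ≤ ENNReal.ofReal t}

/-- The product `X · 𝟙_A` of a random variable and the indicator of a measurable set. -/
def restrict {μ : Measure Ω} (X : Ω →ₘ[μ] ℝ) {A : Set Ω} (hA : MeasurableSet A) : Ω →ₘ[μ] ℝ :=
  AEEqFun.mk (A.indicator X) (X.aestronglyMeasurable.indicator hA)

/-- A rearrangement-invariant norm on random variables (modulo a.s. equality). It is recorded as
an extended norm on all of `L⁰`; the space that carries it is the set where it is finite. -/
structure RINorm (μ : Measure Ω) where
  extNorm : (Ω →ₘ[μ] ℝ) → ℝ≥0∞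
  smul' : ∀ (c : ℝ) (X : Ω →ₘ[μ] ℝ), extNorm (c • X) = ENNReal.ofReal |c| * extNorm X
  add_le' : ∀ X Y : Ω →ₘ[μ] ℝ, extNorm (X + Y) ≤ extNorm X + extNorm Y
  eq_zero' : ∀ X : Ω →ₘ[μ] ℝ, extNorm X = 0 → X = 0
  solid' : ∀ X Y : Ω →ₘ[μ] ℝ, (∀ᵐ ω ∂μ, |Y ω| ≤ |X ω|) → extNorm Y ≤ extNorm X
  law_inv' : ∀ X Z : Ω →ₘ[μ] ℝ, IdentDistrib Z X μ μ → extNorm Z = extNorm X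
  nontrivial' : ∃ X : Ω →ₘ[μ] ℝ, X ≠ 0 ∧ extNorm X < ∞

namespace RINorm

variable {μ : Measure Ω} (N : RINorm μ)

/-- The vector space of the random variables of finite norm. -/
def space : Submodule ℝ (Ω →ₘ[μ] ℝ) where
  carrier := {X | N.extNorm X < ∞}
  add_mem' := fun {X Y} hX hY =>
    lt_of_le_of_lt (N.add_le' X Y) (ENNReal.add_lt_top.2 ⟨hX, hY⟩)
  zero_mem' := by
    have h := N.smul' 0 0
    simp only [smul_zero, abs_zero, ENNReal.ofReal_zero, zero_mul] at h
    simp [h]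
  smul_mem' := fun c X hX => by
    have h := N.smul' c X
    simp only [Set.mem_ofPred_eq] at hX ⊢
    rw [h]
    exact ENNReal.mul_lt_top ENNReal.ofReal_lt_top hX

instance : Norm N.space := ⟨fun X => (N.extNorm X.1).toReal⟩

theorem norm_def (X : N.space) : ‖X‖ = (N.extNorm X.1).toReal := rfl

theorem core : NormedSpace.Core ℝ N.space where
  norm_nonneg _ := ENNReal.toReal_nonneg
  norm_smul c X := by
    rw [norm_def, norm_def, Submodule.coe_smul, N.smul', ENNReal.toReal_mul,
      ENNReal.toReal_ofReal (abs_nonneg c), Real.norm_eq_abs]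
  norm_triangle X Y := by
    rw [norm_def, norm_def, norm_def,
      ← ENNReal.toReal_add (ne_of_lt X.2) (ne_of_lt Y.2)]
    exact ENNReal.toReal_mono (ENNReal.add_lt_top.2 ⟨X.2, Y.2⟩).ne (N.add_le' X.1 Y.1)
  norm_eq_zero_iff X := by
    rw [norm_def]
    constructor
    · intro h
      rcases (ENNReal.toReal_eq_zero_iff _).1 h with h | h
      · exact Subtype.ext (N.eq_zero' _ h)
      · exact absurd h (ne_of_lt X.2)
    · rintro rfl
      have h := N.smul' 0 0
      simp only [smul_zero, abs_zero, ENNReal.ofReal_zero, zero_mul] at h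
      simp [h]

instance : NormedAddCommGroup N.space := NormedAddCommGroup.ofCore N.core

instance : NormedSpace ℝ N.space := NormedSpace.ofCore N.core

/-- An element of the space is used as a function on `Ω`. -/
instance : CoeFun N.space (fun _ => Ω → ℝ) := ⟨fun X => (X.1 : Ω → ℝ)⟩

end RINorm

/-- A rearrangement-invariant (nonzero, Banach) space over `(Ω, μ)`. -/
structure RISpace (μ : Measure Ω) extends RINorm μ where
  complete : CompleteSpace toRINorm.space

namespace RISpace

variable {μ : Measure Ω} (𝒳 : RISpace μ)

/-- The random variables of the space, with their norm. -/
abbrev space : Submodule ℝ (Ω →ₘ[μ] ℝ) := 𝒳.toRINorm.space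

/-- The pointwise supremum of every increasing norm bounded sequence of nonnegative elements
belongs to the space. -/
def MonotonicallyComplete : Prop :=
  ∀ u : ℕ → 𝒳.space, (∀ n, 0 ≤ᵐ[μ] ⇑(u n)) → (∀ n, ⇑(u n) ≤ᵐ[μ] ⇑(u (n + 1))) →
    (∃ C : ℝ, ∀ n, ‖u n‖ ≤ C) →
    ∃ X : 𝒳.space, ∀ᵐ ω ∂μ, IsLUB (Set.range fun n => u n ω) (X ω)

/-- `Span {X - Y : X ∼ Y}`. -/
def S : Submodule ℝ 𝒳.space :=
  Submodule.span ℝ {Z | ∃ X Y : 𝒳.space, IdentDistrib ⇑X ⇑Y μ μ ∧ Z = X - Y}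

/-- The elements with mean zero. -/
def M : Set 𝒳.space := {X | ∫ ω, X ω ∂μ = 0}

/-- The order continuous part: `‖X 𝟙_A‖ → 0` as `μ(A) → 0`. -/
def orderContPart : Set 𝒳.space :=
  {X | ∀ ε : ℝ≥0∞, 0 < ε → ∃ δ : ℝ≥0∞, 0 < δ ∧
    ∀ (A : Set Ω) (hA : MeasurableSet A), μ A < δ → 𝒳.extNorm (restrict X.1 hA) < ε}

/-- The convex hull of the random variables with the same law as `X`. -/
def CL (X : 𝒳.space) : Set 𝒳.space := convexHull ℝ {Y | IdentDistrib ⇑Y ⇑X μ μ}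

/-- Almost Order Continuous Equidistributional Average property: for every `X ≥ 0`, the distance
between `CL X` and the order continuous part is zero. -/
def AOCEA : Prop :=
  ∀ X : 𝒳.space, 0 ≤ᵐ[μ] ⇑X → ∀ ε : ℝ, 0 < ε →
    ∃ Y ∈ 𝒳.CL X, ∃ V ∈ 𝒳.orderContPart, ‖Y - V‖ < ε

/-- Convex combinations of copies of `X 𝟙_{A_n}`, with `A_n ↓ ∅`, can be made small. -/
def SmallConvexCombinations : Prop :=
  ∀ X : 𝒳.space, 0 ≤ᵐ[μ] ⇑X → ∀ ε : ℝ, 0 < ε →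
    ∀ (A : ℕ → Set Ω) (hA : ∀ n, MeasurableSet (A n)), Antitone A → ⋂ n, A n = ∅ →
    ∃ (k : ℕ) (n : Fin k → ℕ) (Z : Fin k → 𝒳.space) (w : Fin k → ℝ),
      (∀ i, 0 ≤ w i) ∧ ∑ i, w i = 1 ∧
      (∀ i, IdentDistrib ⇑(Z i) (restrict X.1 (hA (n i))) μ μ) ∧
      ‖∑ i, w i • Z i‖ < ε

/-- Averages of disjoint copies of `X 𝟙_{A_n}`, with `A_n ↓ ∅` and `∑ μ(A_n) ≤ 1`, can be made
small. -/
def SmallDisjointAverages : Prop :=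
  ∀ X : 𝒳.space, ∀ ε : ℝ, 0 < ε →
    ∀ (A : ℕ → Set Ω) (hA : ∀ n, MeasurableSet (A n)), Antitone A → ⋂ n, A n = ∅ →
    ∑' n, μ (A n) ≤ 1 →
    ∀ Z : ℕ → 𝒳.space,
      (∀ i j, i ≠ j → ∀ᵐ ω ∂μ, Z i ω = 0 ∨ Z j ω = 0) →
      (∀ n, IdentDistrib ⇑(Z n) (restrict X.1 (hA n)) μ μ) →
    ∃ (k : ℕ) (n : Fin k → ℕ), 0 < k ∧ ‖(1 / (k : ℝ)) • ∑ i, Z (n i)‖ < ε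

variable {𝒳}

/-- The functional takes nonnegative values at nonnegative elements. -/
def PositiveFunctional (ρ : 𝒳.space →L[ℝ] ℝ) : Prop :=
  ∀ X : 𝒳.space, 0 ≤ᵐ[μ] ⇑X → 0 ≤ ρ X

/-- The functional depends only on the law. -/
def LawInvariant (ρ : 𝒳.space →L[ℝ] ℝ) : Prop :=
  ∀ X Y : 𝒳.space, IdentDistrib ⇑X ⇑Y μ μ → ρ X = ρ Y

/-- The functional is a scalar multiple of the expectation. -/
def CollapsesToMean (ρ : 𝒳.space →L[ℝ] ℝ) : Prop :=
  ∃ c : ℝ, ∀ X : 𝒳.space, ρ X = c * ∫ ω, X ω ∂μ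

end RISpace

/-- `sup_{n ≥ 1} n 2^n ∫_0^{1/(2^n n!)} X^*(t) dt`, as an extended number. -/
def exampleNorm (X : unitInterval →ₘ[volume] ℝ) : ℝ≥0∞ :=
  ⨆ (n : ℕ) (_ : 1 ≤ n), (n : ℝ≥0∞) * 2 ^ n *
    ∫⁻ t in Set.Ioo (0 : ℝ) (1 / (2 ^ n * (n.factorial : ℝ))),
      ENNReal.ofReal (decRearr volume X t)

/-- `c_n = 1 / (2^n (n+1)!)`. -/
def breakpoint (n : ℕ) : ℝ := 1 / (2 ^ n * ((n + 1).factorial : ℝ))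

/-- `Y = ∑_{n ≥ 3} n! 𝟙_{[c_{n+1}, c_n)}`; the index is shifted, the summand being that of
`n + 3`. -/
def exampleY (ω : unitInterval) : ℝ :=
  ∑' n : ℕ, (Set.Ico (breakpoint (n + 3 + 1)) (breakpoint (n + 3))).indicator
    (fun _ => ((n + 3).factorial : ℝ)) (ω : ℝ)

end RI

end

/-! All the negative assertions come from one functional `ρ` (`exists_isSingular`): positive,
law-invariant, dominated by the norm, zero at bounded random variables, yet positive at Y. A
multiple of the expectation cannot vanish at 1 and be nonzero at Y. The kernel of a bounded
law-invariant functional is closed and contains `S`; for the expectation this gives the inclusion in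
`M`, and for `ρ` it excludes Y - E[Y], where `ρ` equals `ρ` of Y. Copies of Y, or of Y cut down to a
small interval at 0, all have the value `ρ` of Y, so their convex combinations have norm at least
that number; and `ρ` vanishes on the order continuous part.

To build `ρ`, put n = 4^k and average the excess of X over k dyadic levels, from (n-1)! 2^k up to
n!/2; multiply the expectation by n 2^n and pass to an ultrafilter limit in k. The n-th term of the
norm controls this quantity (`weight_mul_integral_absTail_le`). The excess over a single level is
not additive, but its defect is at most three times the level and vanishes at levels above 2
max(|x|, |y|). Over all levels the defects form a geometric sum of order |x| + |y|, so averaging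
leaves O(1/k) (`abs_avgTrunc_add_sub_le`). The gap between (n-1)! and n! is what makes room for k
levels. On the block where Y = n!, each excess is at least half of Y, and the weighted expectation
stays above 1/8 (`approx_exampleYElem_ge`).

That the space is Banach and monotonically complete rests on a variational formula for the integral
of the rearrangement, on a Fatou property, and on domination of the L¹ norm. -/

namespace RI

/-! ### Integrals of the decreasing rearrangement. -/

section Rearrangement

variable {Ω : Type*} [MeasurableSpace Ω] {μ : Measure Ω}

theorem nullMeasurableSet_lt_abs {X : Ω → ℝ} (hX : AEMeasurable X μ) (r : ℝ) :
    NullMeasurableSet {ω | r < |X ω|} μ :=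
  nullMeasurableSet_lt aemeasurable_const hX.abs

theorem exists_measure_lt_abs_le [IsFiniteMeasure μ] {X : Ω → ℝ} (hX : AEMeasurable X μ)
    {t : ℝ≥0∞} (ht : 0 < t) : ∃ r : ℝ, 0 < r ∧ μ {ω | r < |X ω|} ≤ t := by
  have h := tendsto_measure_iInter_atTop (μ := μ) (s := fun n : ℕ => {ω | (n : ℝ) < |X ω|})
    (fun n => nullMeasurableSet_lt_abs hX _)
    (fun m n hmn ω (hω : (n : ℝ) < |X ω|) =>
      show (m : ℝ) < |X ω| from (Nat.cast_le.2 hmn).trans_lt hω)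
    ⟨0, measure_ne_top _ _⟩
  have h0 : ⋂ n : ℕ, {ω | (n : ℝ) < |X ω|} = ∅ := by
    ext ω
    simp only [Set.mem_iInter, Set.mem_ofPred_eq, Set.mem_empty_iff_false, iff_false, not_forall,
      not_lt]
    exact exists_nat_ge _
  rw [h0, measure_empty] at h
  obtain ⟨n, hn, hn1⟩ := ((h.eventually (gt_mem_nhds ht)).and (eventually_ge_atTop 1)).exists
  exact ⟨n, by exact_mod_cast hn1, hn.le⟩

theorem decRearr_nonneg (X : Ω → ℝ) (t : ℝ) : 0 ≤ decRearr μ X t :=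
  Real.sInf_nonneg fun _ hr => hr.1.le

/-- The distribution function is right-continuous, by continuity of the measure along the levels r +
1/(n+1); so rearrangement and distribution function are generalized inverses of each other. -/
theorem lt_decRearr_iff [IsFiniteMeasure μ] {X : Ω → ℝ} (hX : AEMeasurable X μ) {t r : ℝ}
    (ht : 0 < t) (hr : 0 ≤ r) :
    r < decRearr μ X t ↔ ENNReal.ofReal t < μ {ω | r < |X ω|} := by
  have hb : BddBelow {r : ℝ | 0 < r ∧ μ {ω | r < |X ω|} ≤ ENNReal.ofReal t} :=
    ⟨0, fun _ h => h.1.le⟩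
  rw [← not_iff_not, not_lt, not_lt]
  constructor
  · intro h
    have hU : {ω | r < |X ω|} = ⋃ n : ℕ, {ω | r + 1 / ((n : ℝ) + 1) < |X ω|} := by
      ext ω
      simp only [Set.mem_ofPred_eq, Set.mem_iUnion]
      constructor
      · intro h
        obtain ⟨n, hn⟩ := exists_nat_one_div_lt (sub_pos.2 h)
        exact ⟨n, by linarith⟩
      · rintro ⟨n, hn⟩
        have : 0 < 1 / ((n : ℝ) + 1) := by positivity
        linarith
    rw [hU, Monotone.measure_iUnion]
    · refine iSup_le fun n => ?_
      have hlt : decRearr μ X t < r + 1 / ((n : ℝ) + 1) :=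
        lt_of_le_of_lt h (lt_add_of_pos_right _ (by positivity))
      obtain ⟨s, hs, hs'⟩ := exists_lt_of_csInf_lt
        (exists_measure_lt_abs_le hX (ENNReal.ofReal_pos.2 ht)) hlt
      exact (measure_mono fun ω hω => lt_trans hs' hω).trans hs.2
    · intro m n hmn ω hω
      have : 1 / ((n : ℝ) + 1) ≤ 1 / ((m : ℝ) + 1) := by gcongr
      simp only [Set.mem_ofPred_eq] at hω ⊢
      linarith
  · intro h
    refine le_of_forall_pos_le_add fun ε hε => csInf_le hb ⟨by linarith, ?_⟩
    exact (measure_mono fun ω (hω : r + ε < |X ω|) => lt_of_le_of_lt (by linarith) hω).trans h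

theorem decRearr_congr {X Z : Ω → ℝ} (h : ∀ r, μ {ω | r < |Z ω|} = μ {ω | r < |X ω|}) :
    decRearr μ Z = decRearr μ X := by
  funext t
  simp only [decRearr, h]

theorem decRearr_identDistrib {X Z : Ω → ℝ} (h : IdentDistrib Z X μ μ) :
    decRearr μ Z = decRearr μ X :=
  decRearr_congr fun r => h.measure_mem_eq
    (measurableSet_lt measurable_const measurable_id.abs : MeasurableSet {x : ℝ | r < |x|})

theorem antitoneOn_decRearr [IsFiniteMeasure μ] {X : Ω → ℝ} (hX : AEMeasurable X μ) :
    AntitoneOn (decRearr μ X) (Set.Ioi 0) := by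
  intro s hs t ht hst
  by_contra! h
  have := ((lt_decRearr_iff hX ht (decRearr_nonneg X s)).1 h)
  exact lt_irrefl _ ((lt_decRearr_iff hX hs (decRearr_nonneg X s)).2
    ((ENNReal.ofReal_le_ofReal hst).trans_lt this))

/-- The integral `∫_0^s X^*(t) dt`. -/
noncomputable def rearrIntegral (μ : Measure Ω) (X : Ω → ℝ) (s : ℝ) : ℝ≥0∞ :=
  ∫⁻ t in Set.Ioo (0 : ℝ) s, ENNReal.ofReal (decRearr μ X t)

theorem volume_Ioo_inter_lt (s : ℝ) (d : ℝ≥0∞) :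
    volume {t : ℝ | ENNReal.ofReal t < d ∧ t ∈ Set.Ioo 0 s} = min (ENNReal.ofReal s) d := by
  rcases eq_or_ne d ∞ with rfl | hd
  · have : {t : ℝ | ENNReal.ofReal t < ∞ ∧ t ∈ Set.Ioo 0 s} = Set.Ioo 0 s := by ext; simp
    rw [this]; simp
  · have : {t : ℝ | ENNReal.ofReal t < d ∧ t ∈ Set.Ioo 0 s} = Set.Ioo 0 (min s d.toReal) := by
      ext t
      simp only [Set.mem_ofPred_eq, Set.mem_Ioo, lt_min_iff]
      constructor
      · rintro ⟨h, h0, h1⟩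
        exact ⟨h0, h1, (ENNReal.ofReal_lt_iff_lt_toReal h0.le hd).1 h⟩
      · rintro ⟨h0, h1, h⟩
        exact ⟨(ENNReal.ofReal_lt_iff_lt_toReal h0.le hd).2 h, h0, h1⟩
    rw [this, Real.volume_Ioo, sub_zero, ENNReal.ofReal_min, ENNReal.ofReal_toReal hd]

/-- Layer-cake formula: by `lt_decRearr_iff`, the part of (0, s) where the rearrangement exceeds r
is an interval of length min(s, μ(|X| > r)). -/
theorem rearrIntegral_eq_lintegral_min [IsFiniteMeasure μ] {X : Ω → ℝ} (hX : AEMeasurable X μ)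
    (s : ℝ) : rearrIntegral μ X s =
      ∫⁻ r in Set.Ioi (0 : ℝ), min (ENNReal.ofReal s) (μ {ω | r < |X ω|}) := by
  have hm : AEMeasurable (decRearr μ X) (volume.restrict (Set.Ioo (0 : ℝ) s)) :=
    aemeasurable_restrict_of_antitoneOn measurableSet_Ioo
      ((antitoneOn_decRearr hX).mono fun _ h => h.1)
  rw [rearrIntegral, lintegral_eq_lintegral_meas_lt _ (ae_of_all _ (decRearr_nonneg X)) hm]
  refine setLIntegral_congr_fun measurableSet_Ioi fun r hr => ?_
  rw [Measure.restrict_apply₀' measurableSet_Ioo.nullMeasurableSet, ← volume_Ioo_inter_lt]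
  congr 1
  ext t
  simp only [Set.mem_inter_iff, Set.mem_ofPred_eq]
  exact and_congr_left fun ht => lt_decRearr_iff hX ht.1 (le_of_lt hr)

theorem lintegral_sub_eq_lintegral_measure {X : Ω → ℝ} (hX : AEMeasurable X μ) (l : ℝ) :
    ∫⁻ ω, ENNReal.ofReal (|X ω| - l) ∂μ = ∫⁻ r in Set.Ioi l, μ {ω | r < |X ω|} := by
  have h1 : ∀ ω, ENNReal.ofReal (|X ω| - l) = ENNReal.ofReal (max (|X ω| - l) 0) := by
    intro ω; simp
  have hm : AEMeasurable (fun ω => max (|X ω| - l) 0) μ :=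
    (hX.abs.sub_const l).max aemeasurable_const
  have h0 : 0 ≤ᵐ[μ] fun ω => max (|X ω| - l) 0 := ae_of_all _ fun ω => le_max_right _ _
  simp only [h1]
  rw [lintegral_eq_lintegral_meas_lt μ h0 hm]
  have h2 := (measurePreserving_add_right (volume : Measure ℝ) l).setLIntegral_comp_preimage_emb
    (measurableEmbedding_addRight l) (fun r => μ {ω | r < |X ω|}) (Set.Ioi l)
  rw [← h2]
  have h3 : (fun x : ℝ => x + l) ⁻¹' Set.Ioi l = Set.Ioi 0 := by ext; simp
  rw [h3]
  refine setLIntegral_congr_fun measurableSet_Ioi fun r hr => ?_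
  congr 1
  ext ω
  simp only [Set.mem_ofPred_eq, lt_max_iff, not_lt.2 (le_of_lt (Set.mem_Ioi.1 hr)), or_false]
  constructor <;> intro h <;> linarith

theorem setLIntegral_Ioi_split (f : ℝ → ℝ≥0∞) {l : ℝ} (hl : 0 ≤ l) :
    ∫⁻ r in Set.Ioi 0, f r = (∫⁻ r in Set.Ioo 0 l, f r) + ∫⁻ r in Set.Ioi l, f r := by
  rcases hl.eq_or_lt with rfl | hl
  · simp
  rw [← restrict_Ioo_eq_restrict_Ioc.symm, ← lintegral_union measurableSet_Ioi]
  · rw [Set.Ioc_union_Ioi_eq_Ioi hl.le]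
  · exact Set.Ioc_disjoint_Ioi le_rfl

/-- Split the layer-cake integral at l; bound the minimum by s below l and by the distribution
function above. With `exists_rearrIntegral_eq` this expresses the integral as a minimum over l, from
which subadditivity follows. -/
theorem rearrIntegral_le [IsFiniteMeasure μ] {X : Ω → ℝ} (hX : AEMeasurable X μ)
    (s : ℝ) {l : ℝ} (hl : 0 ≤ l) :
    rearrIntegral μ X s ≤ ENNReal.ofReal l * ENNReal.ofReal s +
      ∫⁻ ω, ENNReal.ofReal (|X ω| - l) ∂μ := by
  rw [rearrIntegral_eq_lintegral_min hX, setLIntegral_Ioi_split _ hl,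
    lintegral_sub_eq_lintegral_measure hX]
  gcongr
  · calc _ ≤ ∫⁻ _ in Set.Ioo 0 l, ENNReal.ofReal s := lintegral_mono fun _ => min_le_left _ _
      _ = _ := by simp [mul_comm]
  · exact min_le_right _ _

/-- At l = X^*(s) both bounds of `rearrIntegral_le` are equalities: the distribution function
exceeds s below this level and is at most s above it. -/
theorem exists_rearrIntegral_eq [IsFiniteMeasure μ] {X : Ω → ℝ} (hX : AEMeasurable X μ)
    {s : ℝ} (hs : 0 < s) :
    ∃ l : ℝ, 0 ≤ l ∧ rearrIntegral μ X s = ENNReal.ofReal l * ENNReal.ofReal s +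
      ∫⁻ ω, ENNReal.ofReal (|X ω| - l) ∂μ := by
  have hl := decRearr_nonneg (μ := μ) X s
  refine ⟨decRearr μ X s, hl, ?_⟩
  rw [rearrIntegral_eq_lintegral_min hX, setLIntegral_Ioi_split _ hl,
    lintegral_sub_eq_lintegral_measure hX]
  congr 1
  · calc _ = ∫⁻ _ in Set.Ioo 0 (decRearr μ X s), ENNReal.ofReal s :=
        setLIntegral_congr_fun measurableSet_Ioo fun r hr =>
          min_eq_left ((lt_decRearr_iff hX hs hr.1.le).1 hr.2).le
      _ = _ := by simp [mul_comm]
  · refine setLIntegral_congr_fun measurableSet_Ioi fun r hr => min_eq_right ?_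
    exact not_lt.1 fun h => (lt_asymm hr) ((lt_decRearr_iff hX hs (hl.trans (le_of_lt hr))).2 h)

theorem rearrIntegral_mono [IsFiniteMeasure μ] {X Z : Ω → ℝ} (hX : AEMeasurable X μ)
    (hZ : AEMeasurable Z μ) (h : ∀ᵐ ω ∂μ, |Z ω| ≤ |X ω|) (s : ℝ) :
    rearrIntegral μ Z s ≤ rearrIntegral μ X s := by
  rw [rearrIntegral_eq_lintegral_min hX, rearrIntegral_eq_lintegral_min hZ]
  refine lintegral_mono fun r => min_le_min le_rfl (measure_mono_ae ?_)
  filter_upwards [h] with ω hω h' using lt_of_lt_of_le h' hω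

theorem rearrIntegral_congr [IsFiniteMeasure μ] {X Z : Ω → ℝ} (hX : AEMeasurable X μ)
    (h : Z =ᵐ[μ] X) (s : ℝ) : rearrIntegral μ Z s = rearrIntegral μ X s :=
  le_antisymm
    (rearrIntegral_mono hX (hX.congr h.symm) (h.mono fun _ h => by rw [h]) s)
    (rearrIntegral_mono (hX.congr h.symm) hX (h.mono fun _ h => by rw [h]) s)

/-- If l and m are optimal for the summands, use the level l + m for the sum: the excess of |x + z|
over l + m is at most the sum of the two excesses. -/
theorem rearrIntegral_add_le [IsFiniteMeasure μ] {X Z : Ω → ℝ} (hX : AEMeasurable X μ)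
    (hZ : AEMeasurable Z μ) {s : ℝ} (hs : 0 < s) :
    rearrIntegral μ (X + Z) s ≤ rearrIntegral μ X s + rearrIntegral μ Z s := by
  obtain ⟨l, hl, h⟩ := exists_rearrIntegral_eq hX hs
  obtain ⟨m, hm, h'⟩ := exists_rearrIntegral_eq hZ hs
  refine (rearrIntegral_le (hX.add hZ) s (add_nonneg hl hm)).trans ?_
  rw [h, h', ENNReal.ofReal_add hl hm, add_mul, add_add_add_comm,
    ← lintegral_add_left' (hX.abs.sub_const l).ennreal_ofReal]
  gcongr with ω
  rw [Pi.add_apply]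
  refine (ENNReal.ofReal_le_ofReal ?_).trans ENNReal.ofReal_add_le
  linarith [abs_add_le (X ω) (Z ω)]

theorem rearrIntegral_smul_le [IsFiniteMeasure μ] {X : Ω → ℝ} (hX : AEMeasurable X μ) (c : ℝ)
    {s : ℝ} (hs : 0 < s) :
    rearrIntegral μ (c • X) s ≤ ENNReal.ofReal |c| * rearrIntegral μ X s := by
  obtain ⟨l, hl, h⟩ := exists_rearrIntegral_eq hX hs
  refine (rearrIntegral_le (hX.const_smul c) s (mul_nonneg (abs_nonneg c) hl)).trans ?_
  rw [h, mul_add, ENNReal.ofReal_mul (abs_nonneg c), mul_assoc,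
    ← lintegral_const_mul' _ _ ENNReal.ofReal_ne_top]
  gcongr with ω
  rw [← ENNReal.ofReal_mul (abs_nonneg c), Pi.smul_apply, smul_eq_mul, abs_mul, mul_sub]

theorem setLIntegral_le_rearrIntegral [IsFiniteMeasure μ] {X : Ω → ℝ} (hX : AEMeasurable X μ)
    {s : ℝ} (hs : 0 < s) {A : Set Ω} (hA : μ A ≤ ENNReal.ofReal s) :
    ∫⁻ ω in A, ENNReal.ofReal |X ω| ∂μ ≤ rearrIntegral μ X s := by
  obtain ⟨l, hl, h⟩ := exists_rearrIntegral_eq hX hs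
  rw [h]
  calc ∫⁻ ω in A, ENNReal.ofReal |X ω| ∂μ
      ≤ ∫⁻ ω in A, (ENNReal.ofReal l + ENNReal.ofReal (|X ω| - l)) ∂μ := by
        refine lintegral_mono fun ω => ?_
        refine le_trans (ENNReal.ofReal_le_ofReal ?_) ENNReal.ofReal_add_le
        linarith
    _ = ENNReal.ofReal l * μ A + ∫⁻ ω in A, ENNReal.ofReal (|X ω| - l) ∂μ := by
        rw [lintegral_add_left measurable_const, setLIntegral_const]
    _ ≤ _ := by gcongr; exact Measure.restrict_le_self

theorem mul_le_rearrIntegral [IsFiniteMeasure μ] {X : Ω → ℝ} (hX : AEMeasurable X μ)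
    {s a : ℝ} (h : ENNReal.ofReal s ≤ μ {ω | a < |X ω|}) :
    ENNReal.ofReal a * ENNReal.ofReal s ≤ rearrIntegral μ X s := by
  rw [rearrIntegral_eq_lintegral_min hX]
  calc ENNReal.ofReal a * ENNReal.ofReal s = ∫⁻ _ in Set.Ioo 0 a, ENNReal.ofReal s := by
        simp [mul_comm]
    _ = ∫⁻ r in Set.Ioo 0 a, min (ENNReal.ofReal s) (μ {ω | r < |X ω|}) :=
        setLIntegral_congr_fun measurableSet_Ioo fun r hr => (min_eq_left (h.trans
          (measure_mono fun ω (hω : a < |X ω|) => hr.2.trans hω))).symm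
    _ ≤ _ := lintegral_mono_set fun r hr => hr.1

/-- Since d ≤ 2 min(1/2, d) for d ≤ 1. The right side is exactly the term n = 1 of the norm, which
therefore dominates L¹. -/
theorem lintegral_abs_le_rearrIntegral [IsProbabilityMeasure μ] {X : Ω → ℝ}
    (hX : AEMeasurable X μ) :
    ∫⁻ ω, ENNReal.ofReal |X ω| ∂μ ≤ 2 * rearrIntegral μ X (1 / 2) := by
  have h := lintegral_sub_eq_lintegral_measure hX 0
  simp only [sub_zero] at h
  rw [h, rearrIntegral_eq_lintegral_min hX, ← lintegral_const_mul' _ _ (by simp)]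
  refine lintegral_mono fun r => ?_
  rw [mul_min, le_min_iff]
  constructor
  · refine prob_le_one.trans (le_of_eq ?_)
    rw [← ENNReal.ofReal_ofNat 2, ← ENNReal.ofReal_mul (by norm_num)]
    norm_num
  · exact le_mul_of_one_le_left (zero_le) (by norm_num)

/-- Fatou twice: for the indicators of {|X| > r}, which are lower semicontinuous along the sequence,
and then in the variable r. -/
theorem rearrIntegral_le_liminf [IsFiniteMeasure μ] {X : Ω → ℝ} {Z : ℕ → Ω → ℝ}
    (hX : AEMeasurable X μ) (hZ : ∀ k, AEMeasurable (Z k) μ)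
    (h : ∀ᵐ ω ∂μ, Tendsto (fun k => Z k ω) atTop (𝓝 (X ω))) (s : ℝ) :
    rearrIntegral μ X s ≤ liminf (fun k => rearrIntegral μ (Z k) s) atTop := by
  have hd : ∀ r, μ {ω | r < |X ω|} ≤ liminf (fun k => μ {ω | r < |Z k ω|}) atTop := by
    intro r
    simp only [← fun k => lintegral_indicator_one₀ (nullMeasurableSet_lt_abs (hZ k) r),
      ← lintegral_indicator_one₀ (nullMeasurableSet_lt_abs hX r)]
    refine le_trans (lintegral_mono_ae ?_) (lintegral_liminf_le' fun k =>
      aemeasurable_one.indicator₀ (nullMeasurableSet_lt_abs (hZ k) r))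
    filter_upwards [h] with ω hω
    by_cases hr : r < |X ω|
    · refine le_liminf_of_le (by isBoundedDefault) ?_
      filter_upwards [hω.abs.eventually (lt_mem_nhds hr)] with k hk
      rw [Set.indicator_of_mem (show ω ∈ {ω | r < |X ω|} from hr),
          Set.indicator_of_mem (show ω ∈ {ω | r < |Z k ω|} from hk)]
    · rw [Set.indicator_of_notMem (show ω ∉ {ω | r < |X ω|} from hr)]
      exact zero_le
  have hmeas : ∀ {W : Ω → ℝ}, Measurable fun r : ℝ =>
      min (ENNReal.ofReal s) (μ {ω | r < |W ω|}) := fun {W} => by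
    refine measurable_const.min (Antitone.measurable fun r r' hr => ?_)
    exact measure_mono fun ω (hω : r' < |W ω|) => lt_of_le_of_lt hr hω
  rw [rearrIntegral_eq_lintegral_min hX]
  simp only [fun k => rearrIntegral_eq_lintegral_min (hZ k) s]
  refine le_trans (lintegral_mono fun r => ?_) (lintegral_liminf_le fun k => hmeas)
  have hmono : Monotone fun d : ℝ≥0∞ => min (ENNReal.ofReal s) d :=
    fun _ _ h => min_le_min le_rfl h
  refine (hmono (hd r)).trans (le_of_eq ?_)
  exact hmono.map_liminf_of_continuousAt _ (by fun_prop)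

end Rearrangement

/-! ### The norm, completeness and monotone completeness. -/

section ExampleNorm

theorem le_exampleNorm (X : unitInterval →ₘ[volume] ℝ) {n : ℕ} (hn : 1 ≤ n) :
    (n : ℝ≥0∞) * 2 ^ n * rearrIntegral volume X (1 / (2 ^ n * (n.factorial : ℝ))) ≤
      exampleNorm X :=
  le_iSup₂ (f := fun (n : ℕ) (_ : 1 ≤ n) => (n : ℝ≥0∞) * 2 ^ n *
      rearrIntegral volume X (1 / (2 ^ n * (n.factorial : ℝ)))) n hn

theorem exampleNorm_smul_le (c : ℝ) (X : unitInterval →ₘ[volume] ℝ) :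
    exampleNorm (c • X) ≤ ENNReal.ofReal |c| * exampleNorm X := by
  refine iSup₂_le fun n hn => ?_
  refine le_trans ?_ (mul_le_mul_right (le_exampleNorm X hn) _)
  rw [mul_left_comm]
  gcongr
  change rearrIntegral _ _ _ ≤ _
  rw [rearrIntegral_congr (X.aemeasurable.const_smul c) (AEEqFun.coeFn_smul c X)]
  exact rearrIntegral_smul_le X.aemeasurable c (by positivity)

theorem exampleNorm_add_le (X Y : unitInterval →ₘ[volume] ℝ) :
    exampleNorm (X + Y) ≤ exampleNorm X + exampleNorm Y := by
  refine iSup₂_le fun n hn => ?_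
  refine le_trans ?_ (add_le_add (le_exampleNorm X hn) (le_exampleNorm Y hn))
  rw [← mul_add]
  gcongr
  change rearrIntegral _ _ _ ≤ _
  rw [rearrIntegral_congr (X.aemeasurable.add Y.aemeasurable) (AEEqFun.coeFn_add X Y)]
  exact rearrIntegral_add_le X.aemeasurable Y.aemeasurable (by positivity)

theorem exampleNorm_mono {X Y : unitInterval →ₘ[volume] ℝ} (h : ∀ᵐ ω, |Y ω| ≤ |X ω|) :
    exampleNorm Y ≤ exampleNorm X := by
  refine iSup₂_le fun n hn => ?_
  refine le_trans ?_ (le_exampleNorm X hn)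
  gcongr
  exact rearrIntegral_mono X.aemeasurable Y.aemeasurable h _

theorem lintegral_abs_le_exampleNorm (X : unitInterval →ₘ[volume] ℝ) :
    ∫⁻ ω, ENNReal.ofReal |X ω| ≤ exampleNorm X := by
  refine (lintegral_abs_le_rearrIntegral X.aemeasurable).trans ?_
  simpa using le_exampleNorm X le_rfl

theorem exampleNorm_le_liminf {X : unitInterval →ₘ[volume] ℝ}
    {Z : ℕ → unitInterval →ₘ[volume] ℝ}
    (h : ∀ᵐ ω, Tendsto (fun k => Z k ω) atTop (𝓝 (X ω))) :
    exampleNorm X ≤ liminf (fun k => exampleNorm (Z k)) atTop := by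
  refine iSup₂_le fun n hn => ?_
  have hmono : Monotone fun d : ℝ≥0∞ => (n : ℝ≥0∞) * 2 ^ n * d :=
    fun _ _ h => mul_le_mul_right h _
  have hc : (n : ℝ≥0∞) * 2 ^ n ≠ ∞ :=
    ENNReal.mul_ne_top (ENNReal.natCast_ne_top n) (ENNReal.pow_ne_top (by simp))
  refine (hmono (rearrIntegral_le_liminf X.aemeasurable (fun k => (Z k).aemeasurable) h _)).trans ?_
  refine (hmono.map_liminf_of_continuousAt _
    (ENNReal.continuous_const_mul hc).continuousAt).trans_le ?_
  exact liminf_le_liminf (Eventually.of_forall fun k => le_exampleNorm (Z k) hn)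

/-- Taking l = K in `rearrIntegral_le` removes the excess; the n-th term is then at most K n/n!. -/
theorem exampleNorm_le_of_bounded {X : unitInterval →ₘ[volume] ℝ} {K : ℝ}
    (hK : 0 ≤ K) (h : ∀ᵐ ω, |X ω| ≤ K) : exampleNorm X ≤ ENNReal.ofReal K := by
  refine iSup₂_le fun n hn => ?_
  have h0 : ∫⁻ ω, ENNReal.ofReal (|X ω| - K) = 0 := by
    rw [lintegral_eq_zero_iff' (X.aemeasurable.abs.sub_const K).ennreal_ofReal]
    filter_upwards [h] with ω hω
    simpa using hω
  refine (mul_le_mul_right (rearrIntegral_le X.aemeasurable _ hK) _).trans ?_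
  rw [h0, add_zero, mul_left_comm]
  refine mul_le_of_le_one_right' ?_
  rw [← ENNReal.ofReal_natCast, ← ENNReal.ofReal_ofNat 2, ← ENNReal.ofReal_pow (by norm_num),
    ← ENNReal.ofReal_mul (by positivity), ← ENNReal.ofReal_mul (by positivity)]
  rw [ENNReal.ofReal_le_one, mul_one_div, div_le_one (by positivity), mul_comm]
  gcongr
  exact Nat.self_le_factorial n

/-- The norm `exampleNorm` as a rearrangement-invariant norm. -/
noncomputable def exampleRINorm : RINorm (volume : Measure unitInterval) where
  extNorm := exampleNorm
  smul' c X := by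
    refine le_antisymm (exampleNorm_smul_le c X) ?_
    rcases eq_or_ne c 0 with rfl | hc
    · simp
    · have h := exampleNorm_smul_le c⁻¹ (c • X)
      rw [smul_smul, inv_mul_cancel₀ hc, one_smul] at h
      refine (mul_le_mul_right h _).trans ?_
      rw [← mul_assoc, ← ENNReal.ofReal_mul (abs_nonneg c), ← abs_mul, mul_inv_cancel₀ hc]
      simp
  add_le' := exampleNorm_add_le
  eq_zero' X h := by
    have h0 := le_antisymm ((lintegral_abs_le_exampleNorm X).trans h.le) zero_le
    rw [lintegral_eq_zero_iff' X.aemeasurable.abs.ennreal_ofReal] at h0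
    refine AEEqFun.ext ?_
    filter_upwards [h0, AEEqFun.coeFn_zero (β := ℝ) (μ := (volume : Measure unitInterval))]
      with ω hω hω'
    rw [hω']
    simpa using hω
  solid' _ _ h := exampleNorm_mono h
  law_inv' X Z h := by rw [exampleNorm, exampleNorm, decRearr_identDistrib h]
  nontrivial' := by
    refine ⟨AEEqFun.const _ 1, fun h => ?_, ?_⟩
    · have h1 := AEEqFun.coeFn_const (μ := (volume : Measure unitInterval)) unitInterval (1 : ℝ)
      rw [h] at h1
      obtain ⟨ω, hω, hω'⟩ :=
        (h1.and (AEEqFun.coeFn_zero (β := ℝ) (μ := (volume : Measure unitInterval)))).exists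
      rw [hω'] at hω
      simp at hω
    · refine (exampleNorm_le_of_bounded zero_le_one ?_).trans_lt ENNReal.ofReal_lt_top
      filter_upwards [AEEqFun.coeFn_const (μ := (volume : Measure unitInterval)) unitInterval
        (1 : ℝ)] with ω hω
      simp [hω]

theorem ofReal_norm_exampleRINorm (X : exampleRINorm.space) :
    ENNReal.ofReal ‖X‖ = exampleNorm X.1 :=
  ENNReal.ofReal_toReal (ne_of_lt X.2)

/-- A fast Cauchy sequence is fast Cauchy in L¹, hence converges a.s.; the Fatou property turns the
Cauchy estimates into estimates of the distance to this limit. -/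
theorem exampleRINorm_complete : CompleteSpace exampleRINorm.space := by
  refine Metric.complete_of_convergent_controlled_sequences (fun n => (1 / 2 : ℝ) ^ n)
    (fun n => by positivity) fun u hu => ?_
  have hu' : ∀ N n m, N ≤ n → N ≤ m →
      exampleNorm ((u n).1 - (u m).1) < ENNReal.ofReal ((1 / 2 : ℝ) ^ N) := by
    intro N n m hn hm
    have := hu N n m hn hm
    rw [dist_eq_norm] at this
    rw [← Submodule.coe_sub, ← ofReal_norm_exampleRINorm]
    exact (ENNReal.ofReal_lt_ofReal_iff (by positivity)).2 this
  have hsum : ∑' i : ℕ, ENNReal.ofReal ((1 / 2 : ℝ) ^ i) ≠ ∞ :=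
    (summable_geometric_two).tsum_ofReal_ne_top
  have hconv : ∀ᵐ ω, ∃ l, Tendsto (fun n => u n ω) atTop (𝓝 l) := by
    refine Lp.ae_tendsto_of_cauchy_eLpNorm (fun n => (u n).1.aestronglyMeasurable)
      le_rfl hsum fun N n m hn hm => lt_of_le_of_lt ?_ (hu' N n m hn hm)
    refine le_trans (le_of_eq ?_) (lintegral_abs_le_exampleNorm _)
    rw [eLpNorm_one_eq_lintegral_enorm]
    refine lintegral_congr_ae ?_
    filter_upwards [AEEqFun.coeFn_sub (u n).1 (u m).1] with ω hω
    rw [hω, Real.enorm_eq_ofReal_abs]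
  obtain ⟨f, hf, hlim⟩ := exists_stronglyMeasurable_limit_of_tendsto_ae
    (fun n => (u n).1.aestronglyMeasurable) hconv
  set X : unitInterval →ₘ[volume] ℝ := AEEqFun.mk f hf.aestronglyMeasurable with hX
  have hle : ∀ n, exampleNorm ((u n).1 - X) ≤ ENNReal.ofReal ((1 / 2 : ℝ) ^ n) := by
    intro n
    refine (exampleNorm_le_liminf (Z := fun m => (u n).1 - (u m).1) ?_).trans ?_
    · filter_upwards [hlim, AEEqFun.coeFn_sub (u n).1 X, AEEqFun.coeFn_mk f hf.aestronglyMeasurable,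
        ae_all_iff.2 fun m => AEEqFun.coeFn_sub (u n).1 (u m).1] with ω h1 h2 h3 h4
      rw [h2, Pi.sub_apply, show X ω = f ω from h3]
      simp only [h4, Pi.sub_apply]
      exact tendsto_const_nhds.sub h1
    · refine liminf_le_of_frequently_le' (Eventually.frequently ?_)
      filter_upwards [eventually_ge_atTop n] with m hm using (hu' n n m le_rfl hm).le
  have hmem : X ∈ exampleRINorm.space := by
    have h0 : (u 0).1 - X ∈ exampleRINorm.space := (hle 0).trans_lt ENNReal.ofReal_lt_top
    have := exampleRINorm.space.sub_mem (u 0).2 h0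
    rwa [sub_sub_cancel] at this
  refine ⟨⟨X, hmem⟩, ?_⟩
  rw [tendsto_iff_norm_sub_tendsto_zero]
  refine squeeze_zero (fun n => norm_nonneg _) (fun n => ?_)
    (tendsto_pow_atTop_nhds_zero_of_lt_one (by norm_num) (by norm_num : (1 / 2 : ℝ) < 1))
  have := hle n
  rw [show (u n).1 - X = (u n - (⟨X, hmem⟩ : exampleRINorm.space)).1 from rfl,
    ← ofReal_norm_exampleRINorm] at this
  exact (ENNReal.ofReal_le_ofReal_iff (by positivity)).1 this

/-- The rearrangement-invariant space with the norm `exampleNorm`. -/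
noncomputable def exampleSpace : RISpace (volume : Measure unitInterval) :=
  { exampleRINorm with complete := exampleRINorm_complete }

theorem ofReal_norm (X : exampleSpace.space) : ENNReal.ofReal ‖X‖ = exampleNorm X.1 :=
  ENNReal.ofReal_toReal (ne_of_lt X.2)

theorem integrable_exampleSpace (X : exampleSpace.space) : Integrable ⇑X volume := by
  refine ⟨X.1.aestronglyMeasurable, ?_⟩
  rw [hasFiniteIntegral_iff_norm]
  exact (lintegral_abs_le_exampleNorm X.1).trans_lt X.2

theorem integral_abs_le_norm (X : exampleSpace.space) : ∫ ω, |X ω| ≤ ‖X‖ := by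
  rw [integral_eq_lintegral_of_nonneg_ae (ae_of_all _ fun ω => abs_nonneg _)
    X.1.aemeasurable.abs.aestronglyMeasurable]
  exact ENNReal.toReal_mono (ne_of_lt X.2) (lintegral_abs_le_exampleNorm X.1)

/-- Monotone convergence in L¹ makes the supremum finite a.s.; the Fatou property bounds its norm.
-/
theorem exampleSpace_monotonicallyComplete : exampleSpace.MonotonicallyComplete := by
  rintro u hu0 hmono ⟨C, hC⟩
  have hm : ∀ᵐ ω, Monotone fun n => u n ω :=
    (ae_all_iff.2 hmono).mono fun ω h => monotone_nat_of_le_succ h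
  have hint : ∫⁻ ω, ⨆ n, ENNReal.ofReal (u n ω) ≤ ENNReal.ofReal C := by
    rw [lintegral_iSup' (fun n => (u n).1.aemeasurable.ennreal_ofReal)
      (hm.mono fun ω h n m hnm => ENNReal.ofReal_le_ofReal (h hnm))]
    refine iSup_le fun n => ?_
    calc _ ≤ ∫⁻ ω, ENNReal.ofReal |u n ω| :=
          lintegral_mono fun ω => ENNReal.ofReal_le_ofReal (le_abs_self _)
      _ ≤ exampleNorm (u n).1 := lintegral_abs_le_exampleNorm _
      _ = ENNReal.ofReal ‖u n‖ := (ofReal_norm _).symm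
      _ ≤ _ := ENNReal.ofReal_le_ofReal (hC n)
  have hfin := ae_lt_top' (AEMeasurable.iSup fun n => (u n).1.aemeasurable.ennreal_ofReal)
    (hint.trans_lt ENNReal.ofReal_lt_top).ne
  have hlub : ∀ᵐ ω, Tendsto (fun n => u n ω) atTop (𝓝 (⨆ n, u n ω)) ∧
      IsLUB (Set.range fun n => u n ω) (⨆ n, u n ω) := by
    filter_upwards [hm, hfin] with ω h1 h2
    have hb : BddAbove (Set.range fun n => u n ω) := by
      refine ⟨(⨆ n, ENNReal.ofReal (u n ω)).toReal, ?_⟩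
      rintro _ ⟨n, rfl⟩
      exact (ENNReal.ofReal_le_iff_le_toReal h2.ne).1
        (le_iSup (fun n => ENNReal.ofReal (u n ω)) n)
    exact ⟨tendsto_atTop_ciSup h1 hb, isLUB_ciSup hb⟩
  have hmeas : AEStronglyMeasurable (fun ω => ⨆ n, u n ω) (volume : Measure unitInterval) :=
    aestronglyMeasurable_of_tendsto_ae atTop (fun n => (u n).1.aestronglyMeasurable)
      (hlub.mono fun _ h => h.1)
  have hcoe := AEEqFun.coeFn_mk _ hmeas
  refine ⟨⟨AEEqFun.mk _ hmeas, ?_⟩, ?_⟩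
  · refine lt_of_le_of_lt (b := ENNReal.ofReal C) ?_ ENNReal.ofReal_lt_top
    refine (exampleNorm_le_liminf (Z := fun n => (u n).1) ?_).trans ?_
    · filter_upwards [hlub, hcoe] with ω h1 h2
      rw [h2]
      exact h1.1
    · refine liminf_le_of_frequently_le' (Eventually.frequently (Eventually.of_forall fun n => ?_))
      rw [← ofReal_norm]
      exact ENNReal.ofReal_le_ofReal (hC n)
  · filter_upwards [hlub, hcoe] with ω h1 h2
    simp only [h2]
    exact h1.2

end ExampleNorm

/-! ### Truncations, and averages of them that are almost additive. -/

section Truncation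

/-- The part of `x` beyond the level `l`. -/
noncomputable def trunc (l x : ℝ) : ℝ := x - max (-l) (min l x)

theorem continuous_trunc (l : ℝ) : Continuous (trunc l) := by
  unfold trunc; fun_prop

theorem trunc_eq_zero {l x : ℝ} (h : |x| ≤ l) : trunc l x = 0 := by
  obtain ⟨h1, h2⟩ := abs_le.1 h
  rw [trunc, min_eq_right h2, max_eq_right h1, sub_self]

theorem trunc_of_le {l x : ℝ} (hl : 0 ≤ l) (h : l ≤ x) : trunc l x = x - l := by
  rw [trunc, min_eq_left h, max_eq_right (by linarith)]

theorem trunc_of_le_neg {l x : ℝ} (hl : 0 ≤ l) (h : x ≤ -l) : trunc l x = x + l := by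
  rw [trunc, min_eq_right (by linarith), max_eq_left h]; ring

theorem abs_sub_trunc_le {l : ℝ} (hl : 0 ≤ l) (x : ℝ) : |x - trunc l x| ≤ l := by
  rw [trunc, sub_sub_cancel, abs_le]
  exact ⟨le_max_left _ _, max_le (by linarith) (min_le_left _ _)⟩

theorem abs_trunc_le {l : ℝ} (hl : 0 ≤ l) (x : ℝ) : |trunc l x| ≤ |x| := by
  rcases le_total |x| l with h | h
  · rw [trunc_eq_zero h, abs_zero]; exact abs_nonneg x
  · rcases le_abs'.1 h with h | h
    · rw [trunc_of_le_neg hl h, abs_of_nonpos (by linarith), abs_of_nonpos (by linarith)]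
      linarith
    · rw [trunc_of_le hl h, abs_of_nonneg (by linarith), abs_of_nonneg (by linarith)]
      linarith

theorem trunc_nonneg {l x : ℝ} (hl : 0 ≤ l) (hx : 0 ≤ x) : 0 ≤ trunc l x := by
  rcases le_total x l with h | h
  · rw [trunc_eq_zero (by rwa [abs_of_nonneg hx])]
  · rw [trunc_of_le hl h]; linarith

/-- Each of the three truncations differs from its argument by at most l, and the arguments cancel.
If |x| and |y| are at most l/2, all three vanish. -/
theorem abs_trunc_add_sub_le {l : ℝ} (hl : 0 ≤ l) (x y : ℝ) :
    |trunc l (x + y) - trunc l x - trunc l y| ≤ if l < 2 * max |x| |y| then 3 * l else 0 := by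
  split_ifs with h
  · have h1 := abs_le.1 (abs_sub_trunc_le hl (x + y))
    have h2 := abs_le.1 (abs_sub_trunc_le hl x)
    have h3 := abs_le.1 (abs_sub_trunc_le hl y)
    rw [abs_le]
    constructor <;> linarith [h1.1, h1.2, h2.1, h2.2, h3.1, h3.2]
  · have hx := le_max_left |x| |y|
    have hy := le_max_right |x| |y|
    rw [trunc_eq_zero (by linarith [abs_add_le x y]), trunc_eq_zero (by linarith [abs_nonneg x]),
      trunc_eq_zero (by linarith [abs_nonneg x])]
    simp

theorem sum_geometric_below_le {a B : ℝ} (ha : 0 ≤ a) (hB : 0 ≤ B) (k : ℕ) :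
    (∑ j ∈ Finset.range k, if a * 2 ^ j < B then a * 2 ^ j else 0) ≤ 2 * B := by
  -- The bound by the next level, a 2^k, is needed for the induction: when the term a 2^k < B is
  -- counted, the new sum is at most 2 a 2^k.
  suffices h : (∑ j ∈ Finset.range k, if a * 2 ^ j < B then a * 2 ^ j else 0) ≤ 2 * B ∧
      (∑ j ∈ Finset.range k, if a * 2 ^ j < B then a * 2 ^ j else 0) ≤ a * 2 ^ k from h.1
  induction k with
  | zero => simp [ha, hB]
  | succ k ih =>
    have h0 : 0 ≤ a * 2 ^ k := by positivity
    rw [Finset.sum_range_succ, pow_succ]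
    split_ifs with h
    · constructor <;> linarith [ih.2]
    · constructor <;> linarith [ih.1, ih.2]

/-- The average of `trunc` over the levels `a, 2a, …, 2^(k-1) a`. -/
noncomputable def avgTrunc (a : ℝ) (k : ℕ) (x : ℝ) : ℝ :=
  (1 / (k : ℝ)) * ∑ j ∈ Finset.range k, trunc (a * 2 ^ j) x

/-- `|x|` beyond the level `c`, and `0` below it. -/
noncomputable def absTail (c x : ℝ) : ℝ := {x : ℝ | c < |x|}.indicator (fun x => |x|) x

theorem measurable_absTail (c : ℝ) : Measurable (absTail c) :=
  measurable_id.abs.indicator (measurableSet_lt measurable_const measurable_id.abs)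

theorem absTail_nonneg (c x : ℝ) : 0 ≤ absTail c x :=
  Set.indicator_nonneg (fun x _ => abs_nonneg x) x

theorem absTail_le (c x : ℝ) : absTail c x ≤ |x| :=
  Set.indicator_le_self' (fun x _ => abs_nonneg x) x

theorem absTail_of_lt {c x : ℝ} (h : c < |x|) : absTail c x = |x| :=
  Set.indicator_of_mem (s := {x : ℝ | c < |x|}) h _

theorem absTail_of_le {c x : ℝ} (h : |x| ≤ c) : absTail c x = 0 :=
  Set.indicator_of_notMem (s := {x : ℝ | c < |x|}) (not_lt.2 h) _

theorem continuous_avgTrunc (a : ℝ) (k : ℕ) : Continuous (avgTrunc a k) :=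
  continuous_const.mul (continuous_finsetSum _ fun _ _ => continuous_trunc _)

theorem avgTrunc_nonneg {a : ℝ} (ha : 0 ≤ a) (k : ℕ) {x : ℝ} (hx : 0 ≤ x) :
    0 ≤ avgTrunc a k x :=
  mul_nonneg (by positivity) (Finset.sum_nonneg fun _ _ => trunc_nonneg (by positivity) hx)

theorem le_mul_two_pow {a : ℝ} (ha : 0 ≤ a) (j : ℕ) : a ≤ a * 2 ^ j :=
  le_mul_of_one_le_right ha (one_le_pow₀ one_le_two)

theorem abs_avgTrunc_le {a : ℝ} (ha : 0 ≤ a) (k : ℕ) (x : ℝ) :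
    |avgTrunc a k x| ≤ absTail (a / 2) x := by
  rcases lt_or_ge (a / 2) |x| with h | h
  · rw [absTail_of_lt h, avgTrunc, abs_mul, abs_of_nonneg (by positivity)]
    rcases Nat.eq_zero_or_pos k with rfl | hk
    · simp
    calc _ ≤ 1 / (k : ℝ) * ∑ j ∈ Finset.range k, |x| := by
          gcongr
          exact (Finset.abs_sum_le_sum_abs _ _).trans
            (Finset.sum_le_sum fun j _ => abs_trunc_le (by positivity) x)
      _ = |x| := by
          rw [Finset.sum_const, Finset.card_range, nsmul_eq_mul]
          field_simp
  · rw [absTail_of_le h, avgTrunc, Finset.sum_eq_zero]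
    · simp
    · exact fun j _ => trunc_eq_zero (by linarith [le_mul_two_pow ha j])

/-- With M = max(|x|, |y|), only levels below 2M have a defect, and these levels sum to at most 4M;
the factor 3 gives 12M. The tail starts at a/2 because x + y can pass a once x or y passes a/2. -/
theorem abs_avgTrunc_add_sub_le {a : ℝ} (ha : 0 ≤ a) (k : ℕ) (x y : ℝ) :
    |avgTrunc a k (x + y) - avgTrunc a k x - avgTrunc a k y| ≤
      12 / k * (absTail (a / 2) x + absTail (a / 2) y) := by
  set M := max |x| |y| with hM
  have hM0 : 0 ≤ M := (abs_nonneg x).trans (le_max_left _ _)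
  have h1 : |avgTrunc a k (x + y) - avgTrunc a k x - avgTrunc a k y| ≤
      1 / k * ∑ j ∈ Finset.range k, if a * 2 ^ j < 2 * M then 3 * (a * 2 ^ j) else 0 := by
    rw [avgTrunc, avgTrunc, avgTrunc, ← mul_sub, ← mul_sub, ← Finset.sum_sub_distrib,
      ← Finset.sum_sub_distrib, abs_mul, abs_of_nonneg (by positivity : 0 ≤ 1 / (k : ℝ))]
    gcongr
    exact (Finset.abs_sum_le_sum_abs _ _).trans
      (Finset.sum_le_sum fun j _ => abs_trunc_add_sub_le (by positivity) x y)
  refine h1.trans ?_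
  rw [show 12 / (k : ℝ) * (absTail (a / 2) x + absTail (a / 2) y) =
    1 / k * (12 * (absTail (a / 2) x + absTail (a / 2) y)) by ring]
  gcongr
  rcases lt_or_ge a (2 * M) with h | h
  · have h2 : M ≤ absTail (a / 2) x + absTail (a / 2) y := by
      rcases max_cases |x| |y| with h' | h'
      · rw [absTail_of_lt (show a / 2 < |x| by linarith)]
        linarith [absTail_nonneg (a / 2) y]
      · rw [absTail_of_lt (show a / 2 < |y| by linarith)]
        linarith [absTail_nonneg (a / 2) x]
    have h3 := sum_geometric_below_le ha (by positivity : 0 ≤ 2 * M) k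
    calc _ = 3 * ∑ j ∈ Finset.range k, if a * 2 ^ j < 2 * M then a * 2 ^ j else 0 := by
          rw [Finset.mul_sum]
          exact Finset.sum_congr rfl fun j _ => by split_ifs <;> simp
      _ ≤ _ := by linarith
  · rw [Finset.sum_eq_zero]
    · exact mul_nonneg (by norm_num) (add_nonneg (absTail_nonneg _ _) (absTail_nonneg _ _))
    · exact fun j _ => if_neg (by linarith [le_mul_two_pow ha j])

/-- Every level is at most a 2^(k-1) ≤ x/2, so every truncation leaves at least x/2. -/
theorem half_le_avgTrunc {a : ℝ} (ha : 0 ≤ a) {k : ℕ} (hk : 0 < k) {x : ℝ}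
    (hx : a * 2 ^ k ≤ x) : x / 2 ≤ avgTrunc a k x := by
  have hk' : (0 : ℝ) < k := by exact_mod_cast hk
  calc x / 2 = 1 / (k : ℝ) * ∑ j ∈ Finset.range k, x / 2 := by
        rw [Finset.sum_const, Finset.card_range, nsmul_eq_mul]
        field_simp
    _ ≤ _ := by
        rw [avgTrunc]
        gcongr with j hj
        have h1 : a * 2 ^ (j + 1) ≤ a * 2 ^ k := by
          gcongr
          · exact one_le_two
          · exact Finset.mem_range.1 hj
        have h0 : 0 ≤ a * 2 ^ j := by positivity
        rw [pow_succ] at h1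
        rw [trunc_of_le h0 (by linarith)]
        linarith

end Truncation

/-! ### The singular functional as an ultrafilter limit. -/

section SingularFunctional

/-- The weight `n 2^n` at `n = 4^k`. -/
def weight (k : ℕ) : ℝ := (4 ^ k : ℕ) * 2 ^ (4 ^ k)

/-- The lowest truncation level used at `n = 4^k`. -/
def level (k : ℕ) : ℝ := ((4 ^ k - 1).factorial : ℝ) * 2 ^ k

theorem level_nonneg (k : ℕ) : 0 ≤ level k := by unfold level; positivity

theorem weight_nonneg (k : ℕ) : 0 ≤ weight k := by unfold weight; positivity

theorem pow_mul_factorial_pred (k : ℕ) :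
    ((4 ^ k : ℕ) : ℝ) * ((4 ^ k - 1).factorial : ℝ) = ((4 ^ k).factorial : ℝ) := by
  exact_mod_cast Nat.mul_factorial_pred (by positivity)

/-- The right side tends to infinity, hence eventually exceeds any given norm; this is why the
lowest level carries the factor 2^k. -/
theorem weight_mul_level (k : ℕ) :
    weight k * (level k / 2 * (1 / (2 ^ (4 ^ k) * ((4 ^ k).factorial : ℝ)))) = 2 ^ k / 2 := by
  have h0 : ((4 ^ k).factorial : ℝ) ≠ 0 := by positivity
  rw [weight, level, ← pow_mul_factorial_pred] at *
  field_simp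

/-- The approximations to the singular functional. -/
noncomputable def approx (k : ℕ) (X : exampleSpace.space) : ℝ :=
  weight k * ∫ ω, avgTrunc (level k) k (X ω)

theorem measurable_coe (X : exampleSpace.space) : Measurable ⇑X := X.1.measurable

theorem integrable_absTail (c : ℝ) (X : exampleSpace.space) :
    Integrable (fun ω => absTail c (X ω)) :=
  (integrable_exampleSpace X).mono
    ((measurable_absTail c).comp (measurable_coe X)).aestronglyMeasurable
    (ae_of_all _ fun ω => by
      rw [Real.norm_of_nonneg (absTail_nonneg _ _)]; exact absTail_le _ _)

theorem integrable_avgTrunc {a : ℝ} (ha : 0 ≤ a) (k : ℕ) (X : exampleSpace.space) :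
    Integrable (fun ω => avgTrunc a k (X ω)) :=
  (integrable_absTail (a / 2) X).mono
    ((continuous_avgTrunc a k).measurable.comp (measurable_coe X)).aestronglyMeasurable
    (ae_of_all _ fun ω => by
      rw [Real.norm_of_nonneg (absTail_nonneg _ _)]; exact abs_avgTrunc_le ha k _)

theorem weight_mul_integral_absTail_le (X : exampleSpace.space) {k : ℕ} (hk : ‖X‖ < 2 ^ k / 2) :
    weight k * ∫ ω, absTail (level k / 2) (X ω) ≤ ‖X‖ := by
  have hn : 1 ≤ 4 ^ k := Nat.one_le_pow _ _ (by norm_num)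
  have hw : ((4 ^ k : ℕ) : ℝ≥0∞) * 2 ^ (4 ^ k) = ENNReal.ofReal (weight k) := by
    rw [weight, ENNReal.ofReal_mul (by positivity), ENNReal.ofReal_natCast,
      ENNReal.ofReal_pow (by norm_num), ENNReal.ofReal_ofNat]
  have hF := le_exampleNorm X.1 hn
  rw [← ofReal_norm, hw] at hF
  set t : ℝ := 1 / (2 ^ (4 ^ k) * ((4 ^ k).factorial : ℝ)) with ht
  have ht0 : 0 < t := by positivity
  set A := {ω | level k / 2 < |X ω|} with hA
  have hAm : MeasurableSet A := measurableSet_lt measurable_const (measurable_coe X).abs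
  -- Otherwise the n-th term of the norm, n = 4^k, would be at least 2^k/2 by `weight_mul_level`.
  -- Once the set is this small, the n-th term bounds the integral over it.
  have hAt : volume A ≤ ENNReal.ofReal t := by
    by_contra! h
    have h1 := (mul_le_mul_right (mul_le_rearrIntegral X.1.aemeasurable h.le)
      (ENNReal.ofReal (weight k))).trans hF
    rw [← ENNReal.ofReal_mul (by linarith [level_nonneg k]),
      ← ENNReal.ofReal_mul (weight_nonneg k), weight_mul_level,
      ENNReal.ofReal_le_ofReal_iff (norm_nonneg _)] at h1
    linarith
  have h2 := (mul_le_mul_right (setLIntegral_le_rearrIntegral X.1.aemeasurable ht0 hAt)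
      (ENNReal.ofReal (weight k))).trans hF
  rw [← ENNReal.ofReal_le_ofReal_iff (norm_nonneg _), ENNReal.ofReal_mul (weight_nonneg k),
    ofReal_integral_eq_lintegral_ofReal (integrable_absTail _ X)
      (ae_of_all _ fun ω => absTail_nonneg _ _)]
  refine le_trans (le_of_eq ?_) h2
  congr 1
  rw [← lintegral_indicator hAm]
  refine lintegral_congr fun ω => ?_
  by_cases h : ω ∈ A
  · rw [Set.indicator_of_mem h, absTail_of_lt h]
  · rw [Set.indicator_of_notMem h, absTail_of_le (not_lt.1 h), ENNReal.ofReal_zero]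

theorem eventually_lt_two_pow (c : ℝ) : ∀ᶠ k : ℕ in atTop, c < 2 ^ k / 2 :=
  ((tendsto_pow_atTop_atTop_of_one_lt one_lt_two).atTop_div_const two_pos).eventually_gt_atTop c

theorem abs_approx_le (X : exampleSpace.space) {k : ℕ} (hk : ‖X‖ < 2 ^ k / 2) :
    |approx k X| ≤ ‖X‖ := by
  refine le_trans ?_ (weight_mul_integral_absTail_le X hk)
  rw [approx, abs_mul, abs_of_nonneg (weight_nonneg k)]
  refine mul_le_mul_of_nonneg_left ?_ (weight_nonneg k)
  refine abs_integral_le_integral_abs.trans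
    (integral_mono (integrable_avgTrunc (level_nonneg k) k X).abs (integrable_absTail _ X)
      fun ω => abs_avgTrunc_le (level_nonneg k) k _)

theorem abs_approx_add_sub_le (X Y : exampleSpace.space) {k : ℕ} (hX : ‖X‖ < 2 ^ k / 2)
    (hY : ‖Y‖ < 2 ^ k / 2) :
    |approx k (X + Y) - approx k X - approx k Y| ≤ 12 / k * (‖X‖ + ‖Y‖) := by
  have ha := level_nonneg k
  have hXY : ∫ ω, avgTrunc (level k) k ((X + Y : exampleSpace.space) ω) =
      ∫ ω, avgTrunc (level k) k (X ω + Y ω) := by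
    refine integral_congr_ae ?_
    filter_upwards [AEEqFun.coeFn_add X.1 Y.1] with ω hω
    exact congrArg _ hω
  have hi : Integrable fun ω => avgTrunc (level k) k (X ω + Y ω) := by
    refine (integrable_avgTrunc ha k (X + Y)).congr ?_
    filter_upwards [AEEqFun.coeFn_add X.1 Y.1] with ω hω
    exact congrArg _ hω
  have hiX := integrable_avgTrunc ha k X
  have hiY := integrable_avgTrunc ha k Y
  have hiXY : Integrable fun ω =>
      avgTrunc (level k) k (X ω + Y ω) - avgTrunc (level k) k (X ω) := hi.sub hiX
  have hk : (0 : ℝ) ≤ 12 / k := by positivity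
  calc |approx k (X + Y) - approx k X - approx k Y|
      = weight k * |∫ ω, (avgTrunc (level k) k (X ω + Y ω) - avgTrunc (level k) k (X ω) -
          avgTrunc (level k) k (Y ω))| := by
        rw [integral_sub hiXY hiY, integral_sub hi hiX, approx, approx, approx, hXY,
          ← mul_sub, ← mul_sub, abs_mul, abs_of_nonneg (weight_nonneg k)]
    _ ≤ weight k * ∫ ω, 12 / k * (absTail (level k / 2) (X ω) + absTail (level k / 2) (Y ω)) := by
        refine mul_le_mul_of_nonneg_left (abs_integral_le_integral_abs.trans
          (integral_mono (hiXY.sub hiY).abs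
            (((integrable_absTail _ X).add (integrable_absTail _ Y)).const_mul _)
            fun ω => abs_avgTrunc_add_sub_le ha k _ _)) (weight_nonneg k)
    _ = 12 / k * ((weight k * ∫ ω, absTail (level k / 2) (X ω)) +
          weight k * ∫ ω, absTail (level k / 2) (Y ω)) := by
        rw [integral_const_mul, integral_add (integrable_absTail _ X) (integrable_absTail _ Y)]
        ring
    _ ≤ _ := mul_le_mul_of_nonneg_left (add_le_add (weight_mul_integral_absTail_le X hX)
        (weight_mul_integral_absTail_le Y hY)) hk

theorem eventually_abs_approx_le (X : exampleSpace.space) :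
    ∀ᶠ k in (hyperfilter ℕ : Filter ℕ), |approx k X| ≤ ‖X‖ :=
  Eventually.mono (Nat.hyperfilter_le_atTop (eventually_lt_two_pow ‖X‖))
    fun _ hk => abs_approx_le X hk

theorem exists_tendsto_approx (X : exampleSpace.space) :
    ∃ l, Tendsto (fun k => approx k X) (hyperfilter ℕ : Filter ℕ) (𝓝 l) := by
  obtain ⟨l, -, hl⟩ := (isCompact_Icc (a := -‖X‖) (b := ‖X‖)).ultrafilter_le_nhds
    ((hyperfilter ℕ).map fun k => approx k X) (by
      rw [le_principal_iff]
      exact (eventually_abs_approx_le X).mono fun k hk => abs_le.1 hk)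
  exact ⟨l, hl⟩

theorem tendsto_approx_add_sub (X Y : exampleSpace.space) :
    Tendsto (fun k => approx k (X + Y) - approx k X - approx k Y) atTop (𝓝 0) := by
  refine squeeze_zero_norm' (a := fun k : ℕ => 12 / (k : ℝ) * (‖X‖ + ‖Y‖)) ?_ ?_
  · filter_upwards [eventually_lt_two_pow ‖X‖, eventually_lt_two_pow ‖Y‖] with k hX hY
    exact abs_approx_add_sub_le X Y hX hY
  · have := (tendsto_const_div_atTop_nhds_zero_nat (12 : ℝ)).mul_const (‖X‖ + ‖Y‖)
    rwa [zero_mul] at this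

theorem exists_singular_functional : ∃ ρ : exampleSpace.space →L[ℝ] ℝ,
    ∀ X, Tendsto (fun k => approx k X) (hyperfilter ℕ : Filter ℕ) (𝓝 (ρ X)) := by
  choose f hf using exists_tendsto_approx
  have hadd : ∀ X Y, f (X + Y) = f X + f Y := by
    intro X Y
    have h1 := ((hf (X + Y)).sub (hf X)).sub (hf Y)
    have h2 := tendsto_nhds_unique h1 ((tendsto_approx_add_sub X Y).mono_left Nat.hyperfilter_le_atTop)
    linarith
  let g : exampleSpace.space →+ ℝ := AddMonoidHom.mk' f hadd
  have hg : Continuous g := AddMonoidHomClass.continuous_of_bound g 1 fun X => by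
    rw [one_mul]
    exact le_of_tendsto (hf X).abs (eventually_abs_approx_le X)
  -- Homogeneity is free: a continuous additive map is real-linear.
  exact ⟨g.toRealLinearMap hg, hf⟩

variable {ρ : exampleSpace.space →L[ℝ] ℝ}

theorem abs_le_norm_of_tendsto_approx
    (hρ : ∀ X, Tendsto (fun k => approx k X) (hyperfilter ℕ : Filter ℕ) (𝓝 (ρ X)))
    (X : exampleSpace.space) : |ρ X| ≤ ‖X‖ :=
  le_of_tendsto (hρ X).abs (eventually_abs_approx_le X)

theorem positiveFunctional_of_tendsto_approx
    (hρ : ∀ X, Tendsto (fun k => approx k X) (hyperfilter ℕ : Filter ℕ) (𝓝 (ρ X))) :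
    RISpace.PositiveFunctional ρ := fun X hX =>
  ge_of_tendsto (hρ X) <| Eventually.of_forall fun k => mul_nonneg (weight_nonneg k) <|
    integral_nonneg_of_ae <| hX.mono fun _ h => avgTrunc_nonneg (level_nonneg k) k h

theorem lawInvariant_of_tendsto_approx
    (hρ : ∀ X, Tendsto (fun k => approx k X) (hyperfilter ℕ : Filter ℕ) (𝓝 (ρ X))) :
    RISpace.LawInvariant ρ := by
  intro X Y h
  refine tendsto_nhds_unique (hρ X) ((hρ Y).congr fun k => ?_)
  rw [approx, approx]
  exact congrArg _ (h.comp (continuous_avgTrunc (level k) k).measurable).integral_eq.symm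

/-- The levels tend to infinity, so from some k on the truncations of a bounded variable are zero.
-/
theorem eq_zero_of_tendsto_approx
    (hρ : ∀ X, Tendsto (fun k => approx k X) (hyperfilter ℕ : Filter ℕ) (𝓝 (ρ X)))
    {X : exampleSpace.space} {K : ℝ} (hX : ∀ᵐ ω, |X ω| ≤ K) : ρ X = 0 := by
  refine tendsto_nhds_unique (hρ X) (tendsto_const_nhds.congr' ?_)
  filter_upwards [Nat.hyperfilter_le_atTop (eventually_lt_two_pow K)] with k hk
  rw [approx, integral_eq_zero_of_ae, mul_zero]
  filter_upwards [hX] with ω hω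
  have h1 := abs_avgTrunc_le (level_nonneg k) k (X ω)
  have h2 : (2 : ℝ) ^ k ≤ level k :=
    le_mul_of_one_le_left (by positivity) (by exact_mod_cast Nat.factorial_pos _)
  rw [absTail_of_le (by linarith)] at h1
  simpa using h1

end SingularFunctional

/-! ### Y belongs to the space and is charged by the functional. -/

section Blocks

theorem breakpoint_pos (n : ℕ) : 0 < breakpoint n := by unfold breakpoint; positivity

theorem breakpoint_succ (n : ℕ) : breakpoint (n + 1) = breakpoint n / (2 * (n + 2)) := by
  rw [breakpoint, breakpoint, Nat.factorial_succ (n + 1), pow_succ]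
  push_cast
  field_simp
  ring

theorem breakpoint_succ_le (n : ℕ) : breakpoint (n + 1) ≤ breakpoint n / 2 := by
  rw [breakpoint_succ]
  have := (breakpoint_pos n).le
  gcongr
  linarith [(Nat.cast_nonneg n : (0 : ℝ) ≤ n)]

theorem antitone_breakpoint : Antitone breakpoint :=
  antitone_nat_of_succ_le fun n => (breakpoint_succ_le n).trans
    (by linarith [breakpoint_pos n])

theorem factorial_mul_breakpoint (n : ℕ) :
    (n.factorial : ℝ) * breakpoint n = 1 / (2 ^ n * (n + 1)) := by
  rw [breakpoint, Nat.factorial_succ]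
  push_cast
  field_simp

theorem breakpoint_le_one (n : ℕ) : breakpoint n ≤ 1 := by
  refine (antitone_breakpoint (zero_le : 0 ≤ n)).trans ?_
  simp [breakpoint]

theorem factorial_mul_breakpoint_le_one (n : ℕ) : (n.factorial : ℝ) * breakpoint n ≤ 1 := by
  rw [factorial_mul_breakpoint, div_le_one (by positivity)]
  exact one_le_mul_of_one_le_of_one_le (one_le_pow₀ one_le_two)
    (by linarith [(Nat.cast_nonneg n : (0 : ℝ) ≤ n)])

/-- The function `exampleY` on the whole real line. -/
noncomputable def blockFun (x : ℝ) : ℝ :=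
  ∑' n : ℕ, (Set.Ico (breakpoint (n + 3 + 1)) (breakpoint (n + 3))).indicator
    (fun _ => ((n + 3).factorial : ℝ)) x

theorem exampleY_eq_blockFun (ω : unitInterval) : exampleY ω = blockFun ω := rfl

theorem measurable_blockFun : Measurable blockFun := by
  have h : blockFun = fun x => (∑' n : ℕ,
      (Set.Ico (breakpoint (n + 3 + 1)) (breakpoint (n + 3))).indicator
        (fun _ => ((n + 3).factorial : ℝ≥0∞)) x).toReal := by
    funext x
    rw [ENNReal.tsum_toReal_eq, blockFun]
    · refine tsum_congr fun n => ?_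
      by_cases hx : x ∈ Set.Ico (breakpoint (n + 3 + 1)) (breakpoint (n + 3)) <;> simp [hx]
    · intro n
      by_cases hx : x ∈ Set.Ico (breakpoint (n + 3 + 1)) (breakpoint (n + 3)) <;> simp [hx]
  rw [h]
  exact (Measurable.tsum fun n => measurable_const.indicator measurableSet_Ico).ennreal_toReal

theorem measurable_exampleY : Measurable exampleY :=
  measurable_blockFun.comp measurable_subtype_coe

theorem blockFun_of_mem {n : ℕ} {x : ℝ}
    (hx : x ∈ Set.Ico (breakpoint (n + 3 + 1)) (breakpoint (n + 3))) :
    blockFun x = ((n + 3).factorial : ℝ) := by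
  rw [blockFun, tsum_eq_single n, Set.indicator_of_mem hx]
  intro m hm
  refine Set.indicator_of_notMem (fun hx' => ?_) _
  have := antitone_breakpoint.pairwise_disjoint_on_Ico_succ
    (show m + 3 ≠ n + 3 by omega)
  exact Set.disjoint_left.1 this hx' hx

theorem blockFun_cases (x : ℝ) :
    (∃ n : ℕ, x ∈ Set.Ico (breakpoint (n + 3 + 1)) (breakpoint (n + 3)) ∧
      blockFun x = ((n + 3).factorial : ℝ)) ∨ blockFun x = 0 := by
  by_cases h : ∃ n : ℕ, x ∈ Set.Ico (breakpoint (n + 3 + 1)) (breakpoint (n + 3))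
  · obtain ⟨n, hn⟩ := h
    exact Or.inl ⟨n, hn, blockFun_of_mem hn⟩
  · push Not at h
    right
    rw [blockFun]
    simp only [Set.indicator_of_notMem (h _), tsum_zero]

theorem blockFun_nonneg (x : ℝ) : 0 ≤ blockFun x := by
  rcases blockFun_cases x with ⟨n, -, h⟩ | h <;> rw [h]
  positivity

theorem blockFun_mul_self_le_one (x : ℝ) : blockFun x * x ≤ 1 := by
  rcases blockFun_cases x with ⟨n, hn, h⟩ | h
  · rw [h]
    refine le_trans ?_ (factorial_mul_breakpoint_le_one (n + 3))
    gcongr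
    exact hn.2.le
  · simp [h]

theorem volume_coe_mem {s : Set ℝ} (hs : MeasurableSet s) :
    volume {ω : unitInterval | (ω : ℝ) ∈ s} = volume (s ∩ Set.Icc 0 1) :=
  volume_preimage_coe measurableSet_Icc.nullMeasurableSet hs

theorem volume_block (n : ℕ) :
    volume {ω : unitInterval | (ω : ℝ) ∈ Set.Ico (breakpoint (n + 1)) (breakpoint n)} =
      ENNReal.ofReal (breakpoint n - breakpoint (n + 1)) := by
  rw [volume_coe_mem measurableSet_Ico, Set.inter_eq_left.2, Real.volume_Ico]
  exact fun x hx => ⟨(breakpoint_pos _).le.trans hx.1, hx.2.le.trans (breakpoint_le_one n)⟩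

/-- Only blocks m ≥ n rise above (n-1)!, and block m contributes at most m! c_m = 1/(2^m (m+1)),
which is dominated by a geometric series. -/
theorem lintegral_exampleY_sub_le {n : ℕ} (hn : 1 ≤ n) :
    ∫⁻ ω, ENNReal.ofReal (|exampleY ω| - ((n - 1).factorial : ℝ)) ≤
      ENNReal.ofReal (2 / (n * 2 ^ n)) := by
  set B : ℕ → Set unitInterval := fun m =>
    {ω | (ω : ℝ) ∈ Set.Ico (breakpoint (m + 1)) (breakpoint m)} with hB
  have hBm : ∀ m, MeasurableSet (B m) := fun m => measurable_subtype_coe measurableSet_Ico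
  have hpt : ∀ ω, ENNReal.ofReal (|exampleY ω| - ((n - 1).factorial : ℝ)) ≤
      ∑' j : ℕ, (B (n + j)).indicator (fun _ => ENNReal.ofReal ((n + j).factorial : ℝ)) ω := by
    intro ω
    rw [exampleY_eq_blockFun, abs_of_nonneg (blockFun_nonneg _)]
    rcases blockFun_cases (ω : ℝ) with ⟨m, hm, h⟩ | h
    · rcases le_or_gt n (m + 3) with hnm | hnm
      · refine le_trans ?_ (ENNReal.le_tsum (m + 3 - n))
        have e : n + (m + 3 - n) = m + 3 := by omega
        rw [e, Set.indicator_of_mem (show ω ∈ B (m + 3) from hm), h]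
        refine ENNReal.ofReal_le_ofReal ?_
        linarith [(Nat.cast_nonneg _ : (0 : ℝ) ≤ ((n - 1).factorial : ℝ))]
      · rw [h, ENNReal.ofReal_of_nonpos]
        · exact zero_le
        · rw [sub_nonpos]
          exact_mod_cast Nat.factorial_le (by omega : m + 3 ≤ n - 1)
    · rw [h, ENNReal.ofReal_of_nonpos]
      · exact zero_le
      · simp
  have hn0 : (0 : ℝ) < n := by exact_mod_cast hn
  calc _ ≤ ∫⁻ ω, ∑' j : ℕ,
          (B (n + j)).indicator (fun _ => ENNReal.ofReal ((n + j).factorial : ℝ)) ω :=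
        lintegral_mono hpt
    _ = ∑' j : ℕ, ENNReal.ofReal ((n + j).factorial : ℝ) *
          ENNReal.ofReal (breakpoint (n + j) - breakpoint (n + j + 1)) := by
        rw [lintegral_tsum fun j => (measurable_const.indicator (hBm _)).aemeasurable]
        refine tsum_congr fun j => ?_
        rw [lintegral_indicator_const (hBm _), hB, volume_block]
    _ ≤ ∑' j : ℕ, ENNReal.ofReal (1 / (n * 2 ^ n) * (1 / 2) ^ j) := by
        refine ENNReal.tsum_le_tsum fun j => ?_
        rw [← ENNReal.ofReal_mul (by positivity)]
        refine ENNReal.ofReal_le_ofReal ?_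
        calc _ ≤ ((n + j).factorial : ℝ) * breakpoint (n + j) := by
              gcongr
              linarith [breakpoint_pos (n + j + 1)]
          _ = 1 / (2 ^ (n + j) * (((n + j : ℕ) : ℝ) + 1)) := factorial_mul_breakpoint _
          _ ≤ 1 / (2 ^ (n + j) * n) := by
              gcongr
              push_cast
              linarith [(Nat.cast_nonneg j : (0 : ℝ) ≤ j)]
          _ = _ := by
              rw [one_div_pow, pow_add]
              field_simp
    _ = ENNReal.ofReal (2 / (n * 2 ^ n)) := by
        rw [← ENNReal.ofReal_tsum_of_nonneg (fun j => by positivity)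
          (summable_geometric_two.mul_left _), tsum_mul_left, tsum_geometric_two]
        congr 1
        ring

/-- `exampleY` modulo almost sure equality. -/
noncomputable def exampleYAE : unitInterval →ₘ[volume] ℝ :=
  AEEqFun.mk exampleY measurable_exampleY.aestronglyMeasurable

theorem coeFn_exampleYAE : exampleYAE =ᵐ[volume] exampleY := AEEqFun.coeFn_mk _ _

theorem exampleNorm_exampleY_lt_top : exampleNorm exampleYAE < ∞ := by
  -- The bound 3 comes from the level l = (n-1)!: the part below it contributes 1, the excess 2.
  refine lt_of_le_of_lt (iSup₂_le fun n hn => ?_) (ENNReal.ofReal_lt_top (r := 3))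
  change _ * rearrIntegral _ _ _ ≤ _
  rw [rearrIntegral_congr measurable_exampleY.aemeasurable coeFn_exampleYAE]
  have hn0 : (0 : ℝ) < n := by exact_mod_cast hn
  have hw : (n : ℝ≥0∞) * 2 ^ n = ENNReal.ofReal (n * 2 ^ n) := by
    rw [ENNReal.ofReal_mul (by positivity), ENNReal.ofReal_natCast,
      ENNReal.ofReal_pow (by norm_num), ENNReal.ofReal_ofNat]
  have hf : (n : ℝ) * ((n - 1).factorial : ℝ) = (n.factorial : ℝ) := by
    exact_mod_cast Nat.mul_factorial_pred (by omega)
  refine (mul_le_mul_right ((rearrIntegral_le measurable_exampleY.aemeasurable _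
    (Nat.cast_nonneg (n - 1).factorial)).trans
      (add_le_add le_rfl (lintegral_exampleY_sub_le hn))) _).trans (le_of_eq ?_)
  rw [hw, ← ENNReal.ofReal_mul (by positivity), ← ENNReal.ofReal_add (by positivity) (by positivity),
    ← ENNReal.ofReal_mul (by positivity), ← hf]
  congr 1
  have : ((n - 1).factorial : ℝ) ≠ 0 := by positivity
  field_simp
  norm_num

/-- `exampleY` as an element of the space. -/
noncomputable def exampleYElem : exampleSpace.space := ⟨exampleYAE, exampleNorm_exampleY_lt_top⟩

theorem coeFn_exampleYElem : ⇑exampleYElem =ᵐ[volume] exampleY := coeFn_exampleYAE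

theorem exampleYElem_nonneg : 0 ≤ᵐ[volume] ⇑exampleYElem := by
  filter_upwards [coeFn_exampleYElem] with ω hω
  rw [hω]
  exact blockFun_nonneg _

/-- With n = 4^k, the block has length at least c_n/2, so the product is at least n/(4(n+1)). -/
theorem weight_mul_block_ge (k : ℕ) :
    1 / 8 ≤ weight k * (((4 ^ k).factorial : ℝ) / 2 *
      (breakpoint (4 ^ k) - breakpoint (4 ^ k + 1))) := by
  have h1 := breakpoint_succ_le (4 ^ k)
  have hn : (1 : ℝ) ≤ (4 ^ k : ℕ) := by exact_mod_cast Nat.one_le_pow _ _ (by norm_num)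
  calc (1 : ℝ) / 8 ≤ ((4 ^ k : ℕ) : ℝ) / (4 * (((4 ^ k : ℕ) : ℝ) + 1)) := by
        rw [div_le_div_iff₀ (by norm_num) (by positivity)]
        linarith
    _ = weight k * (((4 ^ k).factorial : ℝ) * breakpoint (4 ^ k)) / 4 := by
        rw [factorial_mul_breakpoint, weight]
        field_simp
    _ = weight k * (((4 ^ k).factorial : ℝ) / 2 * (breakpoint (4 ^ k) / 2)) := by ring
    _ ≤ _ := by
        have := weight_nonneg k
        gcongr
        linarith

theorem approx_exampleYElem_ge {k : ℕ} (hk : 1 ≤ k) : 1 / 8 ≤ approx k exampleYElem := by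
  -- The blocks of Y start at index 3, so k = 0 is excluded.
  have hn : 4 ≤ 4 ^ k := Nat.le_self_pow (by omega) 4
  have ha := level_nonneg k
  set B : Set unitInterval :=
    {ω | (ω : ℝ) ∈ Set.Ico (breakpoint (4 ^ k + 1)) (breakpoint (4 ^ k))} with hB
  have hBm : MeasurableSet B := measurable_subtype_coe measurableSet_Ico
  refine (weight_mul_block_ge k).trans (mul_le_mul_of_nonneg_left ?_ (weight_nonneg k))
  calc _ = ∫ ω, B.indicator (fun _ => ((4 ^ k).factorial : ℝ) / 2) ω := by
        rw [integral_indicator_const _ hBm, Measure.real, hB, volume_block, ENNReal.toReal_ofReal,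
          smul_eq_mul, mul_comm]
        linarith [antitone_breakpoint (Nat.le_succ (4 ^ k))]
    _ ≤ _ := by
        refine integral_mono_ae ((integrable_const _).indicator hBm)
          (integrable_avgTrunc ha k _) ?_
        filter_upwards [coeFn_exampleYElem] with ω hω
        rw [hω, exampleY_eq_blockFun]
        by_cases h : ω ∈ B
        · rw [Set.indicator_of_mem h]
          obtain ⟨m, hm⟩ : ∃ m, 4 ^ k = m + 3 := ⟨4 ^ k - 3, by omega⟩
          have hY : blockFun ω = ((4 ^ k).factorial : ℝ) := by
            rw [hm]
            refine blockFun_of_mem ?_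
            rw [← hm]
            exact h
          rw [← hY]
          -- Twice the top level is (n-1)! 2^k 2^k = n! for n = 4^k, exactly the value of Y on the
          -- block.
          refine half_le_avgTrunc ha hk (le_of_eq ?_)
          rw [hY, level, ← pow_mul_factorial_pred, mul_assoc, ← mul_pow, mul_comm]
          norm_num
        · rw [Set.indicator_of_notMem h]
          exact avgTrunc_nonneg ha k (blockFun_nonneg _)

end Blocks

/-! ### Equidistributed translates. -/

section DisjointCopies

theorem identDistrib_shift {g : ℝ → ℝ} (hg : Measurable g) {d : ℝ} (hd : d + d ≤ 1) :
    IdentDistrib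
      (fun ω : unitInterval => (Set.Ioo d (d + d)).indicator (fun x => g (x - d)) (ω : ℝ))
      (fun ω : unitInterval => (Set.Ioo 0 d).indicator g (ω : ℝ)) volume volume := by
  have hm1 : Measurable
      (fun ω : unitInterval => (Set.Ioo d (d + d)).indicator (fun x => g (x - d)) (ω : ℝ)) :=
    ((hg.comp (measurable_id.sub_const d)).indicator measurableSet_Ioo).comp
      measurable_subtype_coe
  have hm2 : Measurable (fun ω : unitInterval => (Set.Ioo 0 d).indicator g (ω : ℝ)) :=
    (hg.indicator measurableSet_Ioo).comp measurable_subtype_coe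
  have key : ∀ B : Set ℝ, MeasurableSet B → (0 : ℝ) ∉ B →
      volume ((fun ω : unitInterval =>
        (Set.Ioo d (d + d)).indicator (fun x => g (x - d)) (ω : ℝ)) ⁻¹' B) =
      volume ((fun ω : unitInterval => (Set.Ioo 0 d).indicator g (ω : ℝ)) ⁻¹' B) := by
    intro B hB h0
    have e1 : (fun ω : unitInterval =>
        (Set.Ioo d (d + d)).indicator (fun x => g (x - d)) (ω : ℝ)) ⁻¹' B =
        {ω : unitInterval | (ω : ℝ) ∈ (fun x => x - d) ⁻¹' (Set.Ioo 0 d ∩ g ⁻¹' B)} := by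
      ext ω
      simp only [Set.mem_preimage, Set.mem_ofPred_eq, Set.mem_inter_iff, Set.mem_Ioo, sub_pos,
        sub_lt_iff_lt_add]
      by_cases h : (ω : ℝ) ∈ Set.Ioo d (d + d)
      · rw [Set.indicator_of_mem h]
        exact ⟨fun h' => ⟨h, h'⟩, fun h' => h'.2⟩
      · rw [Set.indicator_of_notMem h]
        exact ⟨fun h' => absurd h' h0, fun h' => absurd h'.1 h⟩
    have e2 : (fun ω : unitInterval => (Set.Ioo 0 d).indicator g (ω : ℝ)) ⁻¹' B =
        {ω : unitInterval | (ω : ℝ) ∈ Set.Ioo 0 d ∩ g ⁻¹' B} := by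
      ext ω
      simp only [Set.mem_preimage, Set.mem_ofPred_eq, Set.mem_inter_iff]
      by_cases h : (ω : ℝ) ∈ Set.Ioo 0 d
      · rw [Set.indicator_of_mem h]
        exact ⟨fun h' => ⟨h, h'⟩, fun h' => h'.2⟩
      · rw [Set.indicator_of_notMem h]
        exact ⟨fun h' => absurd h' h0, fun h' => absurd h'.1 h⟩
    have hm : MeasurableSet (Set.Ioo 0 d ∩ g ⁻¹' B) := measurableSet_Ioo.inter (hg hB)
    have hm' : MeasurableSet ((fun x => x - d) ⁻¹' (Set.Ioo 0 d ∩ g ⁻¹' B)) :=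
      measurable_id.sub_const d hm
    have hs : Set.Ioo 0 d ∩ g ⁻¹' B ⊆ Set.Icc 0 1 := fun x hx =>
      ⟨hx.1.1.le, by linarith [hx.1.2]⟩
    have hs' : (fun x => x - d) ⁻¹' (Set.Ioo 0 d ∩ g ⁻¹' B) ⊆ Set.Icc 0 1 := by
      intro x hx
      have h1 : 0 < x - d := hx.1.1
      have h2 : x - d < d := hx.1.2
      exact ⟨by linarith, by linarith⟩
    rw [e1, e2, volume_coe_mem hm', volume_coe_mem hm,
      Set.inter_eq_left.2 hs', Set.inter_eq_left.2 hs]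
    exact (measurePreserving_sub_right volume d).measure_preimage hm.nullMeasurableSet
  refine ⟨hm1.aemeasurable, hm2.aemeasurable, Measure.ext fun B hB => ?_⟩
  rw [Measure.map_apply hm1 hB, Measure.map_apply hm2 hB]
  -- Translation invariance settles Borel sets that avoid the value 0 taken off the intervals; the
  -- others follow by complements.
  by_cases h0 : (0 : ℝ) ∈ B
  · have h := key Bᶜ hB.compl (by simpa using h0)
    rw [Set.preimage_compl, Set.preimage_compl, prob_compl_eq_one_sub (hm1 hB),
      prob_compl_eq_one_sub (hm2 hB)] at h
    exact ((ENNReal.sub_right_inj ENNReal.one_ne_top prob_le_one prob_le_one).1 h)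
  · exact key B hB h0

end DisjointCopies

/-! ### Consequences of the singular functional. -/

section Conclusion

/-- The constant random variables belong to the space. -/
noncomputable def constElem (c : ℝ) : exampleSpace.space :=
  ⟨AEEqFun.const unitInterval c, (exampleNorm_le_of_bounded (abs_nonneg c)
    ((AEEqFun.coeFn_const _ c).mono fun ω hω => by rw [hω]; rfl)).trans_lt ENNReal.ofReal_lt_top⟩

theorem coeFn_constElem (c : ℝ) : ⇑(constElem c) =ᵐ[volume] fun _ => c :=
  AEEqFun.coeFn_const _ c

/-- The expectation as a bounded linear functional. -/
noncomputable def expectation : exampleSpace.space →L[ℝ] ℝ :=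
  LinearMap.mkContinuous
    { toFun := fun X => ∫ ω, X ω
      map_add' := fun X Y => by
        rw [← integral_add (integrable_exampleSpace X) (integrable_exampleSpace Y)]
        exact integral_congr_ae (AEEqFun.coeFn_add X.1 Y.1)
      map_smul' := fun c X => by
        rw [RingHom.id_apply, ← integral_smul]
        exact integral_congr_ae (AEEqFun.coeFn_smul c X.1) } 1
    fun X => by
      rw [one_mul]
      exact abs_integral_le_integral_abs.trans (integral_abs_le_norm X)

theorem expectation_apply (X : exampleSpace.space) : expectation X = ∫ ω, X ω := rfl

theorem closure_S_subset_of_lawInvariant {f : exampleSpace.space →L[ℝ] ℝ}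
    (hf : RISpace.LawInvariant f) :
    closure (exampleSpace.S : Set exampleSpace.space) ⊆ {X | f X = 0} := by
  refine closure_minimal ?_ (isClosed_eq f.continuous continuous_const)
  have h : exampleSpace.S ≤ LinearMap.ker f.toLinearMap := by
    refine Submodule.span_le.2 ?_
    rintro _ ⟨X, Y, hXY, rfl⟩
    change f (X - Y) = 0
    rw [map_sub, hf X Y hXY, sub_self]
  exact h

/-- `X 𝟙_A` as an element of the space. -/
noncomputable def restrictElem (X : exampleSpace.space) {A : Set unitInterval}
    (hA : MeasurableSet A) : exampleSpace.space :=
  ⟨restrict X.1 hA, (exampleNorm_mono (X := X.1) (by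
    filter_upwards [AEEqFun.coeFn_mk _ (X.1.aestronglyMeasurable.indicator hA)] with ω hω
    rw [restrict, hω]
    exact norm_indicator_le_norm_self (⇑X) ω)).trans_lt X.2⟩

theorem coeFn_restrictElem (X : exampleSpace.space) {A : Set unitInterval}
    (hA : MeasurableSet A) : ⇑(restrictElem X hA) =ᵐ[volume] A.indicator ⇑X :=
  AEEqFun.coeFn_mk _ (X.1.aestronglyMeasurable.indicator hA)

/-- The interval `(0, 2^{-(n+1)})`. -/
def initialInterval (n : ℕ) : Set unitInterval :=
  {ω | (ω : ℝ) ∈ Set.Ioo 0 ((1 / 2 : ℝ) ^ (n + 1))}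

theorem measurableSet_initialInterval (n : ℕ) : MeasurableSet (initialInterval n) :=
  measurable_subtype_coe measurableSet_Ioo

theorem antitone_initialInterval : Antitone initialInterval := fun _ _ hmn _ hω =>
  ⟨hω.1, hω.2.trans_le (pow_le_pow_of_le_one (by norm_num) (by norm_num) (by omega))⟩

theorem iInter_initialInterval : ⋂ n, initialInterval n = ∅ := by
  ext ω
  simp only [Set.mem_iInter, Set.mem_empty_iff_false, iff_false, not_forall]
  by_contra! h
  have h0 : (0 : ℝ) < ω := (h 0).1
  obtain ⟨n, hn⟩ := exists_pow_lt_of_lt_one h0 (by norm_num : (1 / 2 : ℝ) < 1)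
  have h1 : (ω : ℝ) < (1 / 2 : ℝ) ^ (n + 1) := (h n).2
  have h2 : (1 / 2 : ℝ) ^ (n + 1) ≤ (1 / 2) ^ n :=
    pow_le_pow_of_le_one (by norm_num) (by norm_num) (by omega)
  linarith

theorem tsum_volume_initialInterval_le : ∑' n, volume (initialInterval n) ≤ 1 := by
  have h : ∀ n, volume (initialInterval n) = ENNReal.ofReal ((1 / 2) ^ n * (1 / 2 : ℝ)) := by
    intro n
    rw [initialInterval, volume_coe_mem measurableSet_Ioo, Set.inter_eq_left.2, Real.volume_Ioo,
      sub_zero, pow_succ]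
    exact fun x hx => ⟨hx.1.le, hx.2.le.trans (pow_le_one₀ (by norm_num) (by norm_num))⟩
  simp only [h]
  rw [← ENNReal.ofReal_tsum_of_nonneg (fun n => by positivity)
    (summable_geometric_two.mul_right _), tsum_mul_right, tsum_geometric_two]
  norm_num

theorem abs_exampleY_le_of_notMem {n : ℕ} {ω : unitInterval} (h : ω ∉ initialInterval n) :
    |exampleY ω| ≤ 2 ^ (n + 1) := by
  rw [exampleY_eq_blockFun, abs_of_nonneg (blockFun_nonneg _)]
  have h1 := blockFun_mul_self_le_one (ω : ℝ)
  by_cases h0 : (0 : ℝ) < ω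
  · have h2 : (1 / 2 : ℝ) ^ (n + 1) ≤ ω := not_lt.1 fun h' => h ⟨h0, h'⟩
    have h3 : blockFun ω * (1 / 2 : ℝ) ^ (n + 1) ≤ 1 :=
      (mul_le_mul_of_nonneg_left h2 (blockFun_nonneg _)).trans h1
    rwa [one_div_pow, mul_one_div, div_le_one (by positivity)] at h3
  · rcases blockFun_cases (ω : ℝ) with ⟨m, hm, -⟩ | h'
    · exact absurd ((breakpoint_pos _).trans_le hm.1) h0
    · rw [h']; positivity

/-- The part of Y on (0, 2^{-(n+1)}) is moved to (2^{-(n+1)}, 2^{-n}); these dyadic intervals are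
disjoint. -/
theorem exists_disjoint_copies : ∃ Z : ℕ → exampleSpace.space,
    (∀ i j, i ≠ j → ∀ᵐ ω, Z i ω = 0 ∨ Z j ω = 0) ∧
    ∀ n, IdentDistrib ⇑(Z n) ⇑(restrictElem exampleYElem (measurableSet_initialInterval n))
      volume volume := by
  set d : ℕ → ℝ := fun n => (1 / 2 : ℝ) ^ (n + 1) with hd
  have hdd : ∀ n, d n + d n = (1 / 2 : ℝ) ^ n := fun n => by
    simp only [hd, pow_succ]; ring
  have hd1 : ∀ n, d n + d n ≤ 1 := fun n => by
    rw [hdd]; exact pow_le_one₀ (by norm_num) (by norm_num)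
  set z : ℕ → unitInterval → ℝ := fun n ω =>
    (Set.Ioo (d n) (d n + d n)).indicator (fun x => blockFun (x - d n)) (ω : ℝ) with hz
  have hzm : ∀ n, Measurable (z n) := fun n =>
    ((measurable_blockFun.comp (measurable_id.sub_const (d n))).indicator measurableSet_Ioo).comp
      measurable_subtype_coe
  have hcoe : ∀ n, AEEqFun.mk (z n) (hzm n).aestronglyMeasurable =ᵐ[volume] z n :=
    fun n => AEEqFun.coeFn_mk _ _
  have hid : ∀ n, IdentDistrib (AEEqFun.mk (μ := volume) (z n) (hzm n).aestronglyMeasurable)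
      ⇑(restrictElem exampleYElem (measurableSet_initialInterval n)) volume volume := by
    intro n
    refine (IdentDistrib.of_ae_eq (AEEqFun.aemeasurable _) (hcoe n)).trans
      ((identDistrib_shift measurable_blockFun (hd1 n)).trans ?_)
    refine (IdentDistrib.of_ae_eq (AEEqFun.aemeasurable _) ?_).symm
    filter_upwards [coeFn_restrictElem exampleYElem (measurableSet_initialInterval n),
      coeFn_exampleYElem] with ω h1 h2
    rw [h1]
    by_cases h : ω ∈ initialInterval n
    · rw [Set.indicator_of_mem h, h2, Set.indicator_of_mem (show (ω : ℝ) ∈ Set.Ioo 0 (d n) from h)]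
      rfl
    · rw [Set.indicator_of_notMem h,
        Set.indicator_of_notMem (show (ω : ℝ) ∉ Set.Ioo 0 (d n) from h)]
  refine ⟨fun n => ⟨AEEqFun.mk (z n) (hzm n).aestronglyMeasurable, ?_⟩, ?_, hid⟩
  · exact (exampleSpace.law_inv' _ _ (hid n)).trans_lt (restrictElem exampleYElem _).2
  · have hlt : ∀ i j, i < j → ∀ ω, z i ω = 0 ∨ z j ω = 0 := by
      intro i j hij ω
      by_cases h : (ω : ℝ) ∈ Set.Ioo (d i) (d i + d i)
      · right
        refine Set.indicator_of_notMem (fun h' => ?_) _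
        have h1 : d j + d j ≤ d i := by
          rw [hdd]
          exact pow_le_pow_of_le_one (by norm_num) (by norm_num) hij
        linarith [h.1, h'.2]
      · exact Or.inl (Set.indicator_of_notMem h _)
    intro i j hij
    filter_upwards [hcoe i, hcoe j] with ω h1 h2
    simp only [h1, h2]
    rcases lt_or_gt_of_ne hij with h | h
    · exact hlt i j h ω
    · exact (hlt j i h ω).symm

/-- A positive law-invariant contraction that vanishes at bounded random variables but not at
`exampleY`. -/
structure IsSingular (ρ : exampleSpace.space →L[ℝ] ℝ) : Prop where
  abs_le : ∀ X, |ρ X| ≤ ‖X‖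
  positive : RISpace.PositiveFunctional ρ
  lawInvariant : RISpace.LawInvariant ρ
  eq_zero : ∀ (X : exampleSpace.space) (K : ℝ), (∀ᵐ ω, |X ω| ≤ K) → ρ X = 0
  pos : 0 < ρ exampleYElem

theorem exists_isSingular : ∃ ρ, IsSingular ρ := by
  obtain ⟨ρ, hρ⟩ := exists_singular_functional
  refine ⟨ρ, abs_le_norm_of_tendsto_approx hρ, positiveFunctional_of_tendsto_approx hρ,
    lawInvariant_of_tendsto_approx hρ, fun _ _ h => eq_zero_of_tendsto_approx hρ h, ?_⟩
  refine lt_of_lt_of_le (by norm_num : (0 : ℝ) < 1 / 8) (ge_of_tendsto (hρ exampleYElem) ?_)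
  exact Eventually.mono (Nat.hyperfilter_le_atTop (eventually_ge_atTop 1))
    fun k hk => approx_exampleYElem_ge hk

namespace IsSingular

variable {ρ : exampleSpace.space →L[ℝ] ℝ} (hρ : IsSingular ρ)
include hρ

/-- The part of X off A is bounded, hence invisible to `ρ`. -/
theorem apply_restrictElem {X : exampleSpace.space} {A : Set unitInterval}
    (hA : MeasurableSet A) {K : ℝ} (h : ∀ᵐ ω, ω ∉ A → |X ω| ≤ K) :
    ρ (restrictElem X hA) = ρ X := by
  have h0 : ρ (X - restrictElem X hA) = 0 := by
    refine hρ.eq_zero _ (max K 0) ?_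
    filter_upwards [h, coeFn_restrictElem X hA, AEEqFun.coeFn_sub X.1 (restrictElem X hA).1]
      with ω h1 h2 h3
    rw [Submodule.coe_sub, h3, Pi.sub_apply, h2]
    by_cases hω : ω ∈ A
    · rw [Set.indicator_of_mem hω, sub_self, abs_zero]
      exact le_max_right _ _
    · rw [Set.indicator_of_notMem hω, sub_zero]
      exact (h1 hω).trans (le_max_left _ _)
  rw [map_sub] at h0
  linarith

/-- Cutting V down to {|V| > K} does not change `ρ`, while for large K order continuity makes the
norm of this part small. -/
theorem apply_orderContPart {V : exampleSpace.space} (hV : V ∈ exampleSpace.orderContPart) :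
    ρ V = 0 := by
  refine abs_nonpos_iff.1 (le_of_forall_pos_le_add fun ε hε => ?_)
  obtain ⟨δ, hδ, h⟩ := hV (ENNReal.ofReal ε) (ENNReal.ofReal_pos.2 hε)
  obtain ⟨t, ht0, htδ⟩ := exists_between hδ
  obtain ⟨K, -, hK⟩ := exists_measure_lt_abs_le V.1.aemeasurable ht0
  have hA : MeasurableSet {ω | K < |V ω|} :=
    measurableSet_lt measurable_const (measurable_coe V).abs
  rw [← hρ.apply_restrictElem hA (ae_of_all _ fun ω hω => not_lt.1 hω), zero_add]
  refine (hρ.abs_le _).trans ?_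
  have h1 := h _ hA (hK.trans_lt htδ)
  exact (ENNReal.ofReal_le_ofReal_iff hε.le).1 ((ofReal_norm (restrictElem V hA)).trans_le h1.le)

theorem apply_initial (n : ℕ) :
    ρ (restrictElem exampleYElem (measurableSet_initialInterval n)) = ρ exampleYElem := by
  refine hρ.apply_restrictElem _ (K := 2 ^ (n + 1)) ?_
  filter_upwards [coeFn_exampleYElem] with ω h1 h2
  rw [h1]
  exact abs_exampleY_le_of_notMem h2

theorem apply_constElem (c : ℝ) : ρ (constElem c) = 0 :=
  hρ.eq_zero _ |c| ((coeFn_constElem c).mono fun ω hω => by rw [hω])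

theorem not_collapsesToMean : ¬ RISpace.CollapsesToMean ρ := by
  rintro ⟨c, hc⟩
  have h1 := hc (constElem 1)
  rw [hρ.apply_constElem, integral_congr_ae (coeFn_constElem 1)] at h1
  have h2 : c = 0 := by simpa using h1.symm
  have h3 := hc exampleYElem
  rw [h2, zero_mul] at h3
  exact hρ.pos.ne' h3

theorem notMem_closure_S {X : exampleSpace.space} (hX : ρ X ≠ 0) :
    X ∉ closure (exampleSpace.S : Set exampleSpace.space) := fun h =>
  hX (closure_S_subset_of_lawInvariant hρ.lawInvariant h)

/-- The convex hull of the copies of Y lies in one level set of `ρ`, and `ρ` vanishes on the order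
continuous part, so their distance is at least `ρ` of Y. -/
theorem not_AOCEA : ¬ exampleSpace.AOCEA := by
  intro h
  obtain ⟨Z, hZ, V, hV, hlt⟩ := h exampleYElem exampleYElem_nonneg _ hρ.pos
  have hZ' : ρ Z = ρ exampleYElem := by
    have : exampleSpace.CL exampleYElem ⊆ ρ ⁻¹' {ρ exampleYElem} :=
      convexHull_min (fun W hW => hρ.lawInvariant _ _ hW)
        ((convex_singleton _).is_linear_preimage ρ.isBoundedLinearMap.toIsLinearMap)
    exact this hZ
  have h1 := (le_abs_self _).trans (hρ.abs_le (Z - V))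
  rw [map_sub, hZ', hρ.apply_orderContPart hV, sub_zero] at h1
  linarith

theorem not_smallConvexCombinations : ¬ exampleSpace.SmallConvexCombinations := by
  intro h
  obtain ⟨k, n, Z, w, -, hw, hZ, hlt⟩ := h exampleYElem exampleYElem_nonneg _ hρ.pos _
    measurableSet_initialInterval antitone_initialInterval iInter_initialInterval
  have h0 : ∀ i, ρ (Z i) = ρ exampleYElem := fun i =>
    (hρ.lawInvariant _ (restrictElem exampleYElem _) (hZ i)).trans (hρ.apply_initial (n i))
  have h1 := (le_abs_self _).trans (hρ.abs_le (∑ i, w i • Z i))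
  simp only [map_sum, map_smul, h0, smul_eq_mul, ← Finset.sum_mul, hw, one_mul] at h1
  linarith

theorem not_smallDisjointAverages : ¬ exampleSpace.SmallDisjointAverages := by
  intro h
  obtain ⟨Z, hdisj, hZ⟩ := exists_disjoint_copies
  obtain ⟨k, n, hk, hlt⟩ := h exampleYElem _ hρ.pos _ measurableSet_initialInterval
    antitone_initialInterval iInter_initialInterval tsum_volume_initialInterval_le Z hdisj hZ
  have h0 : ∀ i, ρ (Z i) = ρ exampleYElem := fun i =>
    (hρ.lawInvariant _ _ (hZ i)).trans (hρ.apply_initial i)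
  have h1 := (le_abs_self _).trans (hρ.abs_le ((1 / (k : ℝ)) • ∑ i, Z (n i)))
  have hk' : (k : ℝ) ≠ 0 := by exact_mod_cast hk.ne'
  simp only [map_sum, map_smul, h0, smul_eq_mul, Finset.sum_const, Finset.card_univ,
    Fintype.card_fin, nsmul_eq_mul] at h1
  rw [← mul_assoc, one_div_mul_cancel hk', one_mul] at h1
  linarith

end IsSingular

/-- The centred random variable `Y - E[Y]`. -/
noncomputable def centredY : exampleSpace.space := exampleYElem - constElem (∫ ω, exampleY ω)

theorem coeFn_centredY :
    ⇑centredY =ᵐ[volume] fun ω => exampleY ω - ∫ ω', exampleY ω' := by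
  filter_upwards [coeFn_exampleYElem, coeFn_constElem (∫ ω, exampleY ω),
    AEEqFun.coeFn_sub exampleYElem.1 (constElem (∫ ω, exampleY ω)).1] with ω h1 h2 h3
  rw [centredY, Submodule.coe_sub, h3, Pi.sub_apply, h1, h2]

theorem centredY_mem_M : centredY ∈ exampleSpace.M := by
  change expectation centredY = 0
  rw [centredY, map_sub, expectation_apply, expectation_apply,
    integral_congr_ae coeFn_exampleYElem, integral_congr_ae (coeFn_constElem _)]
  simp

end Conclusion

end RI

theorem mainTheorem2 :
    ∃ 𝒳 : RI.RISpace (volume : Measure unitInterval),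
      (∀ X : unitInterval →ₘ[volume] ℝ, 𝒳.extNorm X = RI.exampleNorm X) ∧
      (∀ X : 𝒳.space, Integrable ⇑X volume) ∧
      𝒳.MonotonicallyComplete ∧
      closure (𝒳.S : Set 𝒳.space) ⊂ 𝒳.M ∧
      (∃ Y X : 𝒳.space,
        ⇑Y =ᵐ[volume] RI.exampleY ∧
        ⇑X =ᵐ[volume] (fun ω => RI.exampleY ω - ∫ ω', RI.exampleY ω') ∧
        X ∈ 𝒳.M ∧ X ∉ closure (𝒳.S : Set 𝒳.space)) ∧
      (∃ ρ : 𝒳.space →L[ℝ] ℝ, RI.RISpace.PositiveFunctional ρ ∧ RI.RISpace.LawInvariant ρ ∧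
        ¬ RI.RISpace.CollapsesToMean ρ) ∧
      ¬ 𝒳.AOCEA ∧ ¬ 𝒳.SmallConvexCombinations ∧ ¬ 𝒳.SmallDisjointAverages := by
  obtain ⟨ρ, hρ⟩ := RI.exists_isSingular
  have hX : RI.centredY ∉ closure (RI.exampleSpace.S : Set RI.exampleSpace.space) := by
    refine hρ.notMem_closure_S ?_
    rw [RI.centredY, map_sub, hρ.apply_constElem, sub_zero]
    exact hρ.pos.ne'
  refine ⟨RI.exampleSpace, fun _ => rfl, RI.integrable_exampleSpace,
    RI.exampleSpace_monotonicallyComplete, ?_,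
    ⟨RI.exampleYElem, RI.centredY, RI.coeFn_exampleYElem, RI.coeFn_centredY, RI.centredY_mem_M, hX⟩,
    ⟨ρ, hρ.positive, hρ.lawInvariant, hρ.not_collapsesToMean⟩,
    hρ.not_AOCEA, hρ.not_smallConvexCombinations, hρ.not_smallDisjointAverages⟩
  refine (Set.ssubset_iff_of_subset ?_).2 ⟨RI.centredY, RI.centredY_mem_M, hX⟩
  -- The expectation is itself a bounded law-invariant functional, with kernel `M`.
  exact RI.closure_S_subset_of_lawInvariant (f := RI.expectation) fun X Y h => h.integral_eq
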